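/- All graphs are finite, parallel edges are permitted, loops are not. A signed graph is a pair $(G,\Sigma)$ with $\Sigma\subseteq E(G)$; edges in $\Sigma$ are odd, the others even; a path or cycle is odd if it contains an odd number of edges of $\Sigma$; $(G,\Sigma)$ is bipartite if it has no odd cycle (two parallel edges form a cycle). Let $S(G,\Sigma)$ be the set of real symmetric matrices $A=[a_{i,j}]$ indexed by $V(G)$ with $a_{i,j}<0$ if $i,j$ are connected by only even edges, $a_{i,j}>0$ if $i,j$ are connected by only odd edges, $a_{i,j}=0$ if $i\ne j$ and $i,j$ are non-adjacent, and no restriction on the other entries (those with $i=j$ and those where $i,j$ are connected by both even and odd edges). $A$ has the Strong Arnold Property if $X=0$ is the only symmetric matrix $X=[x_{i,j}]$ with $x_{i,j}=0$ whenever $i=j$ or $i,j$ are adjacent, and $AX=0$. Let $\nu(G,\Sigma)$ be the largest nullity of a positive semidefinite $A\in S(G,\Sigma)$ that has the Strong Arnold Property. Let $(G,\Sigma)$ be a signed graph and let $E_1,E_2$ be a partition of $E(G)$ into two nonempty sets. For $i=1,2$ let $V_i$ be the set of all ends of edges in $E_i$ and let $\tilde G_i=(V_i,E_i)$. Suppose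 that $V_1\cap V_2=\{u_1,u_2,u_3\}$ has exactly three elements, that $(\tilde G_2,E_2\cap\Sigma)$ is bipartite and connected, and that $|E_2|\ge 4$. Suppose moreover that some connected component of $\tilde G_2-\{u_1,u_2,u_3\}$ is adjacent to each of $u_1,u_2,u_3$. Let $G_1$ be obtained from $\tilde G_1$ by adding a new vertex $w$ and three edges $u_1w,u_2w,u_3w$, and let $\Sigma_1=(E_1\cap\Sigma)\cup\tilde\Sigma$, where $\tilde\Sigma\subseteq\{u_2w,u_3w\}$ contains $u_iw$ if and only if there is an odd path from $u_1$ to $u_i$ in $(\tilde G_2,E_2\cap\Sigma)$. (Then $(G_1,\Sigma_1)$ is said to form a $3$-split of $(G,\Sigma)$.) Then $$\nu(G,\Sigma)=\nu(G_1,\Sigma_1).$$ -/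

import Mathlib

open scoped Graph

/-- A walk in a multigraph: `G.IsWalk x l y` says that starting at `x` and traversing successively
the edges listed in `l` (each one listed together with the vertex it leads to) one arrives at
`y`. -/
inductive Graph.IsWalk {α β : Type*} (G : Graph α β) : α → List (β × α) → α → Prop
  | nil {x : α} (hx : x ∈ V(G)) : Graph.IsWalk G x [] x
  | cons {x y z : α} {e : β} {l : List (β × α)} (h : G.IsLink e x y)
      (hl : Graph.IsWalk G y l z) : Graph.IsWalk G x ((e, y) :: l) z

/-- A path: a walk all of whose vertices are distinct. -/
def Graph.IsPath {α β : Type*} (G : Graph α β) (x : α) (l : List (β × α)) (y : α) : Prop :=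
  G.IsWalk x l y ∧ (x :: l.map Prod.snd).Nodup

/-- A cycle through `x`: a closed walk of positive length from `x` to `x` with no repeated edge and
no repeated vertex (apart from the two ends). Two parallel edges form a cycle. -/
def Graph.IsCycle {α β : Type*} (G : Graph α β) (x : α) (l : List (β × α)) : Prop :=
  G.IsWalk x l x ∧ l ≠ [] ∧ (l.map Prod.fst).Nodup ∧ (l.map Prod.snd).Nodup

/-- A multigraph is connected if it is nonempty and any two vertices are joined by a path. -/
def Graph.IsConnected {α β : Type*} (G : Graph α β) : Prop :=
  V(G).Nonempty ∧ ∀ x ∈ V(G), ∀ y ∈ V(G), ∃ l, G.IsPath x l y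

/-- The subgraph formed by the edges of `G` lying in `F` and the ends of these edges. -/
def Graph.edgeSubgraph {α β : Type*} (G : Graph α β) (F : Set β) : Graph α β where
  vertexSet := {x | ∃ e ∈ F, G.Inc e x}
  IsLink e x y := e ∈ F ∧ G.IsLink e x y
  isLink_symm _ _ := ⟨fun _ _ h => ⟨h.1, h.2.symm⟩⟩
  eq_or_eq_of_isLink_of_isLink _ _ _ _ _ h h' := h.2.left_eq_or_eq h'.2
  left_mem_of_isLink _ _ _ h := ⟨_, h.1, h.2.inc_left⟩

/-- Add to `H` a new vertex `none` and, for each `i`, a new edge `Sum.inr i` joining the new vertex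
to `u i`. (In the intended use each `u i` is already a vertex of `H`.) -/
def Graph.addClaw {α β : Type*} (H : Graph α β) (u : Fin 3 → α) :
    Graph (Option α) (β ⊕ Fin 3) where
  vertexSet := insert none (some '' (V(H) ∪ Set.range u))
  IsLink e a b :=
    (∃ f x y, e = Sum.inl f ∧ a = some x ∧ b = some y ∧ H.IsLink f x y) ∨
    (∃ i, e = Sum.inr i ∧ ((a = some (u i) ∧ b = none) ∨ (a = none ∧ b = some (u i))))
  isLink_symm _ _ := ⟨by
    rintro a b (⟨f, x, y, rfl, rfl, rfl, h⟩ | ⟨i, rfl, h⟩)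
    · exact Or.inl ⟨f, y, x, rfl, rfl, rfl, h.symm⟩
    · exact Or.inr ⟨i, rfl, by tauto⟩⟩
  eq_or_eq_of_isLink_of_isLink := by
    rintro e a b c d (⟨f, x, y, rfl, rfl, rfl, h⟩ | ⟨i, rfl, h⟩)
      (⟨f', x', y', he, rfl, rfl, h'⟩ | ⟨i', he, h'⟩)
    · cases he
      rcases h.left_eq_or_eq h' with h | h <;> simp [h]
    · cases he
    · cases he
    · cases he
      rcases h with ⟨rfl, rfl⟩ | ⟨rfl, rfl⟩ <;> rcases h' with ⟨rfl, rfl⟩ | ⟨rfl, rfl⟩ <;> simp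
  left_mem_of_isLink := by
    rintro e a b (⟨f, x, y, rfl, rfl, rfl, h⟩ | ⟨i, rfl, ⟨rfl, rfl⟩ | ⟨rfl, rfl⟩⟩)
    · exact Set.mem_insert_of_mem _ ⟨x, Or.inl h.left_mem, rfl⟩
    · exact Set.mem_insert_of_mem _ ⟨u i, Or.inr ⟨i, rfl⟩, rfl⟩
    · exact Set.mem_insert _ _

/-- A signed graph: a finite multigraph without loops (parallel edges are permitted) together with
a set of odd edges; the other edges are the even ones. -/
structure SignedGraph (α β : Type*) where
  graph : Graph α β
  loopless : graph.Loopless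
  finite_vertexSet : V(graph).Finite
  finite_edgeSet : E(graph).Finite
  odd : Set β
  odd_subset : odd ⊆ E(graph)

namespace SignedGraph

/-- The type of vertices of a signed graph. -/
abbrev Vertex {α β : Type*} (G : SignedGraph α β) : Type _ := ↥V(G.graph)

noncomputable instance {α β : Type*} (G : SignedGraph α β) : Fintype G.Vertex :=
  G.finite_vertexSet.fintype

/-- The part of the signed graph formed by the edges in `F`, with the signs kept. -/
def edgeSubgraph {α β : Type*} (G : SignedGraph α β) (F : Set β) : SignedGraph α β where
  graph := G.graph.edgeSubgraph F
  loopless := ⟨fun e x h => G.loopless.not_isLoopAt e x h.2⟩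
  finite_vertexSet := G.finite_vertexSet.subset fun _ ⟨_, _, h⟩ => h.vertex_mem
  finite_edgeSet := G.finite_edgeSet.subset fun _ ⟨_, _, h⟩ => h.2.edge_mem
  odd := F ∩ G.odd
  odd_subset := by
    rintro e ⟨heF, he⟩
    obtain ⟨x, y, h⟩ := Graph.exists_isLink_of_mem_edgeSet (G.odd_subset he)
    exact ⟨x, y, heF, h⟩

open scoped Classical in
/-- The number of odd edges among the edges of a walk (for paths and cycles no edge is repeated). -/
noncomputable def oddCount {α β : Type*} (G : SignedGraph α β) (l : List (β × α)) : ℕ :=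
  l.countP fun p => decide (p.1 ∈ G.odd)

/-- There is an odd path between `x` and `y`. -/
def HasOddPath {α β : Type*} (G : SignedGraph α β) (x y : α) : Prop :=
  ∃ l, G.graph.IsPath x l y ∧ Odd (G.oddCount l)

/-- A signed graph is bipartite if it has no odd cycle. -/
def IsBipartite {α β : Type*} (G : SignedGraph α β) : Prop :=
  ∀ x l, G.graph.IsCycle x l → ¬ Odd (G.oddCount l)

/-- The set `S(G, Σ)` of symmetric matrices described by the signed graph. -/
structure IsMatrix {α β : Type*} (G : SignedGraph α β) (A : Matrix G.Vertex G.Vertex ℝ) :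
    Prop where
  symm : A.IsSymm
  neg : ∀ i j : G.Vertex, G.graph.Adj i j →
    (∀ e, G.graph.IsLink e i j → e ∉ G.odd) → A i j < 0
  pos : ∀ i j : G.Vertex, G.graph.Adj i j →
    (∀ e, G.graph.IsLink e i j → e ∈ G.odd) → 0 < A i j
  zero : ∀ i j : G.Vertex, i ≠ j → ¬ G.graph.Adj i j → A i j = 0

/-- The Strong Arnold Property. -/
def HasSAP {α β : Type*} (G : SignedGraph α β) (A : Matrix G.Vertex G.Vertex ℝ) : Prop :=
  ∀ X : Matrix G.Vertex G.Vertex ℝ, X.IsSymm →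
    (∀ i j : G.Vertex, i = j ∨ G.graph.Adj i j → X i j = 0) → A * X = 0 → X = 0

/-- `G.HasNullity k`: some positive semidefinite matrix in `S(G, Σ)` with the Strong Arnold Property
has nullity `k`. -/
def HasNullity {α β : Type*} (G : SignedGraph α β) (k : ℕ) : Prop :=
  ∃ A : Matrix G.Vertex G.Vertex ℝ, G.IsMatrix A ∧ A.PosSemidef ∧ G.HasSAP A ∧
    Module.finrank ℝ (LinearMap.ker A.mulVecLin) = k

/-- The parameter `ν(G, Σ)`: the largest nullity of a positive semidefinite matrix in `S(G, Σ)` that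
has the Strong Arnold Property. The supremum is attained, see `isGreatest_nu`. -/
noncomputable def nu {α β : Type*} (G : SignedGraph α β) : ℕ :=
  sSup {k | G.HasNullity k}

theorem exists_hasNullity {α β : Type*} (G : SignedGraph α β) : ∃ k, G.HasNullity k := by
  classical
  have hadj : ∀ i j : G.Vertex, G.graph.Adj i j → i ≠ j := by
    rintro i j ⟨e, h⟩ rfl
    exact G.loopless.not_isLoopAt e _ h
  obtain ⟨B, hB⟩ : ∃ B : Matrix G.Vertex G.Vertex ℝ, B = Matrix.of fun i j : G.Vertex =>
      if G.graph.Adj i j then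
        (if ∀ e, G.graph.IsLink e i j → e ∉ G.odd then (-1 : ℝ) else 1) else 0 := ⟨_, rfl⟩
  have hBabs : ∀ i j, |B i j| ≤ 1 := by
    intro i j
    rw [hB]
    simp only [Matrix.of_apply]
    split_ifs <;> simp
  have hBsymm : ∀ i j, B i j = B j i := by
    intro i j
    rw [hB]
    simp only [Matrix.of_apply]
    simp only [Graph.adj_comm (x := (i : α)), Graph.isLink_comm (x := (i : α))]
  obtain ⟨A, hA⟩ : ∃ A : Matrix G.Vertex G.Vertex ℝ,
      A = B + ((Fintype.card G.Vertex : ℝ) + 1) • (1 : Matrix G.Vertex G.Vertex ℝ) := ⟨_, rfl⟩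
  have hAne : ∀ i j, i ≠ j → A i j = B i j := by
    intro i j h
    simp [hA, Matrix.one_apply_ne h]
  have hAsymm : A.IsSymm := by
    ext i j
    by_cases h : i = j
    · subst h; rfl
    · rw [Matrix.transpose_apply, hAne _ _ (Ne.symm h), hAne _ _ h, hBsymm]
  have hpd : A.PosDef := by
    refine Matrix.PosDef.of_dotProduct_mulVec_pos ?_ ?_
    · rw [Matrix.IsHermitian, Matrix.conjTranspose_eq_transpose_of_trivial]
      exact hAsymm
    · intro x hx
      have hsq : 0 < ∑ i, x i ^ 2 := by
        obtain ⟨i, hi⟩ := Function.ne_iff.mp hx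
        exact Finset.sum_pos' (fun _ _ => sq_nonneg _) ⟨i, Finset.mem_univ _, by
          have : x i ≠ 0 := hi
          positivity⟩
      have h1 : ∀ i j, -((x i ^ 2 + x j ^ 2) / 2) ≤ x i * (B i j * x j) := by
        intro i j
        obtain ⟨h1, h2⟩ := abs_le.mp (hBabs i j)
        nlinarith [mul_nonneg (sub_nonneg.mpr h2) (sq_nonneg (x i - x j)),
          mul_nonneg (sub_nonneg.mpr h1) (sq_nonneg (x i + x j)), sq_nonneg (x i + x j),
          sq_nonneg (x i - x j)]
      have h2 : -((Fintype.card G.Vertex : ℝ) * ∑ i, x i ^ 2) ≤ x ⬝ᵥ (B.mulVec x) := by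
        have : ∑ i, ∑ j, -((x i ^ 2 + x j ^ 2) / 2) ≤ ∑ i, ∑ j, x i * (B i j * x j) :=
          Finset.sum_le_sum fun i _ => Finset.sum_le_sum fun j _ => h1 i j
        have h3 : ∑ i, ∑ j, -((x i ^ 2 + x j ^ 2) / 2) =
            -((Fintype.card G.Vertex : ℝ) * ∑ i, x i ^ 2) := by
          simp only [Finset.sum_neg_distrib, ← Finset.sum_div, Finset.sum_add_distrib,
            Finset.sum_const, Finset.card_univ, nsmul_eq_mul, ← Finset.mul_sum]
          ring
        rw [h3] at this
        simpa only [dotProduct, Matrix.mulVec, Finset.mul_sum] using this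
      have h4 : star x ⬝ᵥ (A.mulVec x) = x ⬝ᵥ (B.mulVec x) +
          ((Fintype.card G.Vertex : ℝ) + 1) * ∑ i, x i ^ 2 := by
        have : x ⬝ᵥ x = ∑ i, x i ^ 2 := by simp [dotProduct, sq]
        rw [hA, Matrix.add_mulVec, Matrix.smul_mulVec, Matrix.one_mulVec, star_trivial,
          dotProduct_add, dotProduct_smul, this, smul_eq_mul]
      rw [h4]
      linarith
  refine ⟨_, A, ⟨hAsymm, ?_, ?_, ?_⟩, hpd.posSemidef, ?_, rfl⟩
  · intro i j h he
    rw [hAne _ _ (hadj i j h), hB]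
    simp only [Matrix.of_apply]
    rw [if_pos h, if_pos he]
    norm_num
  · intro i j h he
    rw [hAne _ _ (hadj i j h), hB]
    simp only [Matrix.of_apply]
    obtain ⟨e, hel⟩ := h
    rw [if_pos ⟨e, hel⟩, if_neg fun h' => h' e hel (he e hel)]
    norm_num
  · intro i j hij h
    rw [hAne _ _ hij, hB]
    simp only [Matrix.of_apply]
    rw [if_neg h]
  · intro X _ _ hX
    have hu : IsUnit A := hpd.isUnit
    exact hu.mul_right_eq_zero.mp hX

theorem isGreatest_nu {α β : Type*} (G : SignedGraph α β) :
    IsGreatest {k | G.HasNullity k} G.nu := by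
  have hb : BddAbove {k | G.HasNullity k} := by
    refine ⟨Fintype.card G.Vertex, ?_⟩
    rintro k ⟨A, -, -, -, rfl⟩
    exact (Submodule.finrank_le _).trans (by simp)
  exact ⟨Nat.sSup_mem G.exists_hasNullity hb, fun k hk => le_csSup hb hk⟩

/-- The signed graph obtained from the part of `G` on the edge set `E₁` by adding a new vertex `none`
joined to `u 0`, `u 1`, `u 2` by one new edge each. The edge to `u 0` is even; for `i = 1, 2` the
edge to `u i` is odd if and only if the part of `G` on `E₂` has an odd path from `u 0` to `u i`. -/
def clawPart {α β : Type*} (G : SignedGraph α β) (E₁ E₂ : Set β) (u : Fin 3 → α) :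
    SignedGraph (Option α) (β ⊕ Fin 3) where
  graph := (G.edgeSubgraph E₁).graph.addClaw u
  loopless := ⟨by
    rintro e a (⟨f, x, y, rfl, rfl, hxy, h⟩ | ⟨i, rfl, ⟨rfl, h⟩ | ⟨rfl, h⟩⟩)
    · cases hxy
      exact (G.edgeSubgraph E₁).loopless.not_isLoopAt f x h
    · cases h
    · cases h⟩
  finite_vertexSet :=
    (((G.edgeSubgraph E₁).finite_vertexSet.union (Set.finite_range u)).image some).insert none
  finite_edgeSet := by
    refine (((G.edgeSubgraph E₁).finite_edgeSet.image Sum.inl).union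
      (Set.finite_range (Sum.inr : Fin 3 → β ⊕ Fin 3))).subset ?_
    rintro e ⟨a, b, ⟨f, x, y, rfl, -, -, h⟩ | ⟨i, rfl, -⟩⟩
    · exact Or.inl ⟨f, h.edge_mem, rfl⟩
    · exact Or.inr ⟨i, rfl⟩
  odd := Sum.inl '' (E₁ ∩ G.odd) ∪
    Sum.inr '' {i : Fin 3 | i ≠ 0 ∧ (G.edgeSubgraph E₂).HasOddPath (u 0) (u i)}
  odd_subset := by
    rintro e (⟨f, hf, rfl⟩ | ⟨i, -, rfl⟩)
    · obtain ⟨x, y, h⟩ :=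
        Graph.exists_isLink_of_mem_edgeSet ((G.edgeSubgraph E₁).odd_subset hf)
      exact ⟨some x, some y, Or.inl ⟨f, x, y, rfl, rfl, rfl, h⟩⟩
    · exact ⟨some (u i), none, Or.inr ⟨i, rfl, Or.inl ⟨rfl, rfl⟩⟩⟩

/-- The edge partition `E₁, E₂` and the enumeration `u 0, u 1, u 2` of the common vertices define a
`3`-split of `G`. -/
structure IsThreeSplit {α β : Type*} (G : SignedGraph α β) (E₁ E₂ : Set β) (u : Fin 3 → α) :
    Prop where
  union_eq : E₁ ∪ E₂ = E(G.graph)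
  disjoint : Disjoint E₁ E₂
  nonempty_left : E₁.Nonempty
  nonempty_right : E₂.Nonempty
  injective : Function.Injective u
  range_eq : Set.range u = V((G.edgeSubgraph E₁).graph) ∩ V((G.edgeSubgraph E₂).graph)
  bipartite : (G.edgeSubgraph E₂).IsBipartite
  connected : (G.edgeSubgraph E₂).graph.IsConnected
  four_le : 4 ≤ E₂.ncard

/-- Deleting `u 0, u 1, u 2` from the part of `G` on `E₂` leaves a connected component that is
adjacent to all three of them. In terms of paths: from some vertex `w` of this part, distinct from
all `u i`, each `u i` can be reached by a path in this part that avoids the other two. -/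
def HasRootedClaw {α β : Type*} (G : SignedGraph α β) (E₂ : Set β) (u : Fin 3 → α) : Prop :=
  ∃ w ∈ V((G.edgeSubgraph E₂).graph), (∀ i, w ≠ u i) ∧
    ∀ i, ∃ l, (G.edgeSubgraph E₂).graph.IsPath w l (u i) ∧ ∀ j, j ≠ i → u j ∉ l.map Prod.snd

end SignedGraph

/-! A connected bipartite part on `E₂` is balanced: its odd edges form a cut
(`IsBipartite.exists_cut`). Switching signs along this cut, which amounts to conjugating matrices by
a diagonal ±1 matrix (`RealizesNullity.switch`), makes `E₂` even and also makes the claw even,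
because the claw signs record the sides of the cut. It remains to compare two all-even networks
hanging on the same three terminals.

Write `A` in blocks `P`, `Q`, `Qᵀ`, `N`, with `N` on the vertices outside the part on `E₁`. If the
nullity is at least 2, the Strong Arnold Property forces `N` to be positive definite
(`FitsPattern.posDef_right`). Then the Schur complement `P - Q N⁻¹ Qᵀ` determines both
semidefiniteness and nullity. The network enters it through the response `Q N⁻¹ Qᵀ`, which vanishes
outside the terminals and is positive between them. A symmetric 3×3 array has just three
off-diagonal entries, so rescaling the three terminals produces any positive off-diagonal response
(`exists_scaling`, `IsTripodNetwork.exists_networkMatrix`); diagonal entries are unrestricted and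
absorb the rest. Hence one network can replace the other with the Schur complement unchanged
(`RealizesNullity.replace_network`).

The Strong Arnold Property survives because a test matrix `X` is determined by its block `Y` on the
part on `E₁`, and `Y` vanishes between terminals in any case: near each terminal the network forces
the two relevant entries of `Y` to have opposite signs or to vanish, and three numbers cannot be
pairwise of opposite signs (`IsNetworkMatrix.terminals_eq_zero`, `StrongArnold.of_schur_eq`).

Nullities below 2 need no transfer, since every nonempty signed graph attains nullity 1
(`SignedGraph.hasNullity_one`). -/

namespace Matrix

/-! ### Schur complements: semidefiniteness and nullity -/

section SchurComplement

variable {R C : Type*} [Fintype R] [Fintype C] [DecidableEq C]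

theorem PosDef.inv_mul_self {N : Matrix C C ℝ} (hN : N.PosDef) : N⁻¹ * N = 1 :=
  Matrix.nonsing_inv_mul _ ((Matrix.isUnit_iff_isUnit_det _).mp hN.isUnit)

theorem PosDef.self_mul_inv {N : Matrix C C ℝ} (hN : N.PosDef) : N * N⁻¹ = 1 :=
  Matrix.mul_nonsing_inv _ ((Matrix.isUnit_iff_isUnit_det _).mp hN.isUnit)

theorem PosDef.isSymm {V : Type*} [Fintype V] {N : Matrix V V ℝ} (hN : N.PosDef) : N.IsSymm := by
  have := hN.isHermitian
  rwa [Matrix.IsHermitian, Matrix.conjTranspose_eq_transpose_of_trivial] at this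

theorem PosSemidef.isSymm {V : Type*} [Fintype V] {N : Matrix V V ℝ} (hN : N.PosSemidef) :
    N.IsSymm := by
  have := hN.isHermitian
  rwa [Matrix.IsHermitian, Matrix.conjTranspose_eq_transpose_of_trivial] at this

theorem PosDef.inv_isSymm {N : Matrix C C ℝ} (hN : N.PosDef) : N⁻¹.IsSymm :=
  hN.inv.isSymm

theorem PosDef.posSemidef_fromBlocks_iff {N : Matrix C C ℝ} (hN : N.PosDef)
    (P : Matrix R R ℝ) (Q : Matrix R C ℝ) :
    (fromBlocks P Q Qᵀ N).PosSemidef ↔ (P - Q * N⁻¹ * Qᵀ).PosSemidef := by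
  have := hN.isUnit.invertible
  have h := PosDef.fromBlocks₂₂ P Q hN
  rwa [Matrix.conjTranspose_eq_transpose_of_trivial] at h

/-- The lower block row forces a kernel vector to have the form `(a, -N⁻¹ Qᵀ a)`, and the upper row
then says that `a` is in the kernel of the Schur complement. -/
theorem PosDef.finrank_ker_fromBlocks {N : Matrix C C ℝ} (hN : N.PosDef)
    (P : Matrix R R ℝ) (Q : Matrix R C ℝ) :
    Module.finrank ℝ (LinearMap.ker (fromBlocks P Q Qᵀ N).mulVecLin) =
      Module.finrank ℝ (LinearMap.ker (P - Q * N⁻¹ * Qᵀ).mulVecLin) := by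
  have hinv : ∀ x, N *ᵥ (N⁻¹ *ᵥ x) = x := fun x => by
    rw [mulVec_mulVec, hN.self_mul_inv, one_mulVec]
  have hinv' : ∀ x, N⁻¹ *ᵥ (N *ᵥ x) = x := fun x => by
    rw [mulVec_mulVec, hN.inv_mul_self, one_mulVec]
  let f : (R → ℝ) →ₗ[ℝ] (R ⊕ C → ℝ) :=
    { toFun := fun a => Sum.elim a (-(N⁻¹ *ᵥ (Qᵀ *ᵥ a)))
      map_add' := fun a b => by
        ext (i | i) <;> simp [mulVec_add, add_comm]
      map_smul' := fun t a => by
        ext (i | i) <;> simp [mulVec_smul] }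
  have hf : Function.Injective f := fun a b h => by
    ext i
    exact congrFun h (Sum.inl i)
  have hmap : (LinearMap.ker (P - Q * N⁻¹ * Qᵀ).mulVecLin).map f =
      LinearMap.ker (fromBlocks P Q Qᵀ N).mulVecLin := by
    ext x
    simp only [Submodule.mem_map, LinearMap.mem_ker, mulVecLin_apply]
    constructor
    · rintro ⟨a, ha, rfl⟩
      rw [sub_mulVec, ← mulVec_mulVec, ← mulVec_mulVec] at ha
      change fromBlocks P Q Qᵀ N *ᵥ Sum.elim a (-(N⁻¹ *ᵥ (Qᵀ *ᵥ a))) = 0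
      rw [fromBlocks_mulVec]
      ext (i | i)
      · simpa [mulVec_neg, sub_eq_add_neg] using congrFun ha i
      · change (Qᵀ *ᵥ a + N *ᵥ -(N⁻¹ *ᵥ (Qᵀ *ᵥ a))) i = 0
        rw [mulVec_neg, hinv, add_neg_cancel, Pi.zero_apply]
    · intro hx
      obtain ⟨a, b, rfl⟩ : ∃ a b, x = Sum.elim a b :=
        ⟨x ∘ Sum.inl, x ∘ Sum.inr, (Sum.elim_comp_inl_inr x).symm⟩
      rw [fromBlocks_mulVec] at hx
      have h1 : P *ᵥ a + Q *ᵥ b = 0 := funext fun i => congrFun hx (Sum.inl i)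
      have h2 : Qᵀ *ᵥ a + N *ᵥ b = 0 := funext fun i => congrFun hx (Sum.inr i)
      have hb : b = -(N⁻¹ *ᵥ (Qᵀ *ᵥ a)) := by
        rw [eq_neg_of_add_eq_zero_left h2, mulVec_neg, hinv', neg_neg]
      refine ⟨a, ?_, by rw [hb]; rfl⟩
      rw [sub_mulVec, ← mulVec_mulVec, ← mulVec_mulVec]
      rw [hb, mulVec_neg] at h1
      rw [sub_eq_add_neg, h1]
  rw [← hmap]
  exact (Submodule.equivMapOfInjective f hf _).finrank_eq.symm

end SchurComplement

theorem PosDef.transpose_schur {R C : Type*} [Fintype C] [DecidableEq C]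
    {N : Matrix C C ℝ} (hN : N.PosDef) (Q : Matrix R C ℝ) :
    (Q * N⁻¹ * Qᵀ)ᵀ = Q * N⁻¹ * Qᵀ := by
  rw [transpose_mul, transpose_mul, transpose_transpose, hN.inv_isSymm.eq, Matrix.mul_assoc]

/-! ### Matrices with nonpositive off-diagonal entries -/

section ZMatrix

variable {C : Type*} [Fintype C]

/-- Split `h = p - m` into positive and negative parts. Their supports are disjoint, so `m ⬝ᵥ N p ≤
0`, while `m ⬝ᵥ N h ≥ 0`; hence `m ⬝ᵥ N m ≤ 0` and `m = 0`. -/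
theorem nonneg_of_mulVec_nonneg {N : Matrix C C ℝ} (hN : N.PosDef)
    (hoff : ∀ i j, i ≠ j → N i j ≤ 0) {h : C → ℝ} (hh : ∀ i, 0 ≤ (N *ᵥ h) i) (i : C) :
    0 ≤ h i := by
  obtain ⟨m, hm⟩ : ∃ m : C → ℝ, m = fun i => max (-h i) 0 := ⟨_, rfl⟩
  obtain ⟨p, hp⟩ : ∃ p : C → ℝ, p = fun i => max (h i) 0 := ⟨_, rfl⟩
  have hpm : h = p - m := by
    ext i
    simp only [hp, hm, Pi.sub_apply]
    rcases le_total (h i) 0 with h' | h'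
    · rw [max_eq_right h', max_eq_left (by linarith)]; ring
    · rw [max_eq_left h', max_eq_right (by linarith)]; ring
  have hm0 : ∀ i, 0 ≤ m i := fun i => by rw [hm]; exact le_max_right _ _
  have hp0 : ∀ i, 0 ≤ p i := fun i => by rw [hp]; exact le_max_right _ _
  have hdisj : ∀ i, m i * p i = 0 := fun i => by
    simp only [hp, hm]
    rcases le_total (h i) 0 with h' | h'
    · rw [max_eq_right h', mul_zero]
    · rw [max_eq_right (a := -h i) (by linarith), zero_mul]
  have h1 : 0 ≤ m ⬝ᵥ (N *ᵥ h) := Finset.sum_nonneg fun i _ => mul_nonneg (hm0 i) (hh i)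
  have h2 : m ⬝ᵥ (N *ᵥ p) ≤ 0 := by
    simp only [dotProduct, mulVec, Finset.mul_sum]
    refine Finset.sum_nonpos fun i _ => Finset.sum_nonpos fun j _ => ?_
    by_cases hij : i = j
    · subst hij
      rw [mul_left_comm, hdisj, mul_zero]
    · have := mul_nonneg (hm0 i) (hp0 j)
      nlinarith [hoff i j hij]
  have h3 : m = 0 := by
    by_contra hne
    have := hN.dotProduct_mulVec_pos hne
    rw [hpm, mulVec_sub, dotProduct_sub] at h1
    rw [star_trivial] at this
    linarith
  rw [hpm, h3, sub_zero]
  exact hp0 i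

/-- Passing to absolute values cannot increase the quadratic form, whose minimum 0 is attained
exactly on the kernel. -/
theorem mulVec_abs_eq_zero {N : Matrix C C ℝ} (hN : N.PosSemidef)
    (hoff : ∀ i j, i ≠ j → N i j ≤ 0) {z : C → ℝ} (hz : N *ᵥ z = 0) :
    N *ᵥ (fun i => |z i|) = 0 := by
  rw [← hN.dotProduct_mulVec_zero_iff, star_trivial]
  refine le_antisymm ?_ (by simpa using hN.dotProduct_mulVec_nonneg fun i => |z i|)
  have h0 : z ⬝ᵥ (N *ᵥ z) = 0 := by rw [hz, dotProduct_zero]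
  rw [← h0]
  simp only [dotProduct, mulVec, Finset.mul_sum]
  refine Finset.sum_le_sum fun i _ => Finset.sum_le_sum fun j _ => ?_
  by_cases hij : i = j
  · subst hij
    have := abs_mul_abs_self (z i)
    rw [mul_left_comm, this, mul_left_comm]
  · have h1 : z i * z j ≤ |z i| * |z j| := (le_abs_self _).trans_eq (abs_mul _ _)
    nlinarith [hoff i j hij]

end ZMatrix

end Matrix

open Matrix Relation

/-! ### Networks on three terminals and their response -/

section StrongArnold

variable {V : Type*} [Fintype V]

/-- The Strong Arnold Property of a matrix with respect to an arbitrary relation. -/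
def StrongArnold (adj : V → V → Prop) (A : Matrix V V ℝ) : Prop :=
  ∀ X : Matrix V V ℝ, X.IsSymm → (∀ i j, i = j ∨ adj i j → X i j = 0) → A * X = 0 → X = 0

end StrongArnold

/-- A symmetric relation on `R ⊕ C` meeting `R` only in the three terminals `u i`: every vertex of
`C` is isolated or joined to `R`, and some vertex `w` of `C` is joined to all the terminals through
`C`. -/
structure IsTripodNetwork {R C : Type*} (u : Fin 3 → R) (F : R ⊕ C → R ⊕ C → Prop) : Prop where
  symm : ∀ x y, F x y → F y x
  mem_range : ∀ r x, F (Sum.inl r) x → r ∈ Set.range u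
  grounded : ∀ c, (∃ r, ReflTransGen F (Sum.inr c) (Sum.inl r)) ∨ ∀ x, ¬ F (Sum.inr c) x
  claw : ∃ w : C, ∀ i, ReflTransGen (fun x y => F x y ∧ x.isRight) (Sum.inr w) (Sum.inl (u i))

/-- `Q` and `N` are the blocks `R × C` and `C × C` of a matrix whose off-diagonal entries are
negative on the pairs in `F` and zero on the other pairs. -/
structure IsNetworkMatrix {R C : Type*} (F : R ⊕ C → R ⊕ C → Prop) (Q : Matrix R C ℝ)
    (N : Matrix C C ℝ) : Prop where
  neg_left : ∀ r c, F (Sum.inl r) (Sum.inr c) → Q r c < 0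
  zero_left : ∀ r c, ¬ F (Sum.inl r) (Sum.inr c) → Q r c = 0
  neg_right : ∀ c d, c ≠ d → F (Sum.inr c) (Sum.inr d) → N c d < 0
  zero_right : ∀ c d, c ≠ d → ¬ F (Sum.inr c) (Sum.inr d) → N c d = 0

namespace IsNetworkMatrix

variable {R C : Type*} {F : R ⊕ C → R ⊕ C → Prop} {Q : Matrix R C ℝ} {N : Matrix C C ℝ}

theorem left_nonpos (h : IsNetworkMatrix F Q N) (r : R) (c : C) : Q r c ≤ 0 := by
  by_cases hF : F (Sum.inl r) (Sum.inr c)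
  · exact (h.neg_left r c hF).le
  · exact (h.zero_left r c hF).le

theorem right_nonpos (h : IsNetworkMatrix F Q N) (c d : C) (hcd : c ≠ d) : N c d ≤ 0 := by
  by_cases hF : F (Sum.inr c) (Sum.inr d)
  · exact (h.neg_right c d hcd hF).le
  · exact (h.zero_right c d hcd hF).le

theorem left_eq_zero (h : IsNetworkMatrix F Q N) {u : Fin 3 → R} (hF : IsTripodNetwork u F)
    {r : R} (hr : r ∉ Set.range u) (c : C) : Q r c = 0 :=
  h.zero_left r c fun h' => hr (hF.mem_range _ _ h')

variable [Fintype C] [DecidableEq C]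

theorem inv_mul_nonpos (h : IsNetworkMatrix F Q N) (hN : N.PosDef) (c : C) (r : R) :
    (N⁻¹ * Qᵀ) c r ≤ 0 := by
  have := nonneg_of_mulVec_nonneg hN h.right_nonpos (h := fun c => -(N⁻¹ * Qᵀ) c r) (fun d => by
    have h1 : (N *ᵥ fun c => -(N⁻¹ * Qᵀ) c r) d = -(N * (N⁻¹ * Qᵀ)) d r := by
      simp [mulVec, dotProduct, Matrix.mul_apply (M := N)]
    rw [h1, ← Matrix.mul_assoc, hN.self_mul_inv, Matrix.one_mul, transpose_apply]
    linarith [h.left_nonpos r d]) c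
  linarith

/-- Were the entry zero, row `c` of `N * (N⁻¹ * Qᵀ) = Qᵀ` would be a sum of nonnegative terms in
column `r`, against `Q r c < 0`. The same maximum-principle argument spreads negativity from a
neighbour in `inv_mul_neg_of_right`. -/
theorem inv_mul_neg_of_left (h : IsNetworkMatrix F Q N) (hN : N.PosDef) {c : C} {r : R}
    (hF : F (Sum.inl r) (Sum.inr c)) : (N⁻¹ * Qᵀ) c r < 0 := by
  refine lt_of_le_of_ne (h.inv_mul_nonpos hN c r) fun h0 => ?_
  have h1 : (N * (N⁻¹ * Qᵀ)) c r < 0 := by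
    rw [← Matrix.mul_assoc, hN.self_mul_inv, Matrix.one_mul, transpose_apply]
    exact h.neg_left r c hF
  rw [Matrix.mul_apply] at h1
  refine h1.not_ge (Finset.sum_nonneg fun d _ => ?_)
  by_cases hd : c = d
  · rw [← hd, h0, mul_zero]
  · exact mul_nonneg_of_nonpos_of_nonpos (h.right_nonpos c d hd) (h.inv_mul_nonpos hN d r)

theorem inv_mul_neg_of_right (h : IsNetworkMatrix F Q N) (hN : N.PosDef) {c d : C} {r : R}
    (hF : F (Sum.inr c) (Sum.inr d)) (hd : (N⁻¹ * Qᵀ) d r < 0) : (N⁻¹ * Qᵀ) c r < 0 := by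
  by_cases hcd : c = d
  · rwa [hcd]
  refine lt_of_le_of_ne (h.inv_mul_nonpos hN c r) fun h0 => ?_
  have h1 : (N * (N⁻¹ * Qᵀ)) c r ≤ 0 := by
    rw [← Matrix.mul_assoc, hN.self_mul_inv, Matrix.one_mul, transpose_apply]
    exact h.left_nonpos r c
  rw [Matrix.mul_apply] at h1
  refine h1.not_gt (Finset.sum_pos' (fun e _ => ?_) ⟨d, Finset.mem_univ _, ?_⟩)
  · by_cases he : c = e
    · rw [← he, h0, mul_zero]
    · exact mul_nonneg_of_nonpos_of_nonpos (h.right_nonpos c e he) (h.inv_mul_nonpos hN e r)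
  · exact mul_pos_of_neg_of_neg (h.neg_right c d hcd hF) hd

theorem inv_mul_neg_of_reflTransGen (h : IsNetworkMatrix F Q N) (hN : N.PosDef)
    (hF : ∀ x y, F x y → F y x) {r : R} {c : C}
    (hc : ReflTransGen (fun x y => F x y ∧ x.isRight) (Sum.inr c) (Sum.inl r)) :
    (N⁻¹ * Qᵀ) c r < 0 := by
  suffices ∀ x, ReflTransGen (fun x y => F x y ∧ x.isRight) x (Sum.inl r) →
      ∀ c, x = Sum.inr c → (N⁻¹ * Qᵀ) c r < 0 from this _ hc _ rfl
  intro x hx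
  induction hx using ReflTransGen.head_induction_on with
  | refl => intro c hc; cases hc
  | @head x y hxy hy ih =>
    rintro c rfl
    rcases y with s | d
    · rcases hy.cases_head with hy | ⟨z, hz, -⟩
      · cases hy
        exact h.inv_mul_neg_of_left hN (hF _ _ hxy.1)
      · simp at hz
    · exact h.inv_mul_neg_of_right hN hxy.1 (ih d rfl)

/-- Negativity towards all three terminals holds at the claw centre `w` and spreads along its path
to `u i`; the last vertex before `u i` is the required `c`. -/
theorem exists_adjacent_forall_inv_mul_neg (h : IsNetworkMatrix F Q N) (hN : N.PosDef)
    {u : Fin 3 → R} (hF : IsTripodNetwork u F) (i : Fin 3) :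
    ∃ c, F (Sum.inl (u i)) (Sum.inr c) ∧ ∀ j, (N⁻¹ * Qᵀ) c (u j) < 0 := by
  obtain ⟨w, hw⟩ := hF.claw
  have hw0 : ∀ j, (N⁻¹ * Qᵀ) w (u j) < 0 := fun j =>
    h.inv_mul_neg_of_reflTransGen hN hF.symm (hw j)
  suffices ∀ y, ReflTransGen (fun x y => F x y ∧ x.isRight) (Sum.inr w) y →
      (∀ c, y = Sum.inr c → ∀ j, (N⁻¹ * Qᵀ) c (u j) < 0) ∧
      ∀ r, y = Sum.inl r → ∃ c, F y (Sum.inr c) ∧ ∀ j, (N⁻¹ * Qᵀ) c (u j) < 0 from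
    (this _ (hw i)).2 _ rfl
  intro y hy
  induction hy with
  | refl => exact ⟨by rintro c hc; cases hc; exact hw0, by rintro r hr; cases hr⟩
  | @tail x y _ hxy ih =>
    obtain ⟨c, rfl⟩ : ∃ c, x = Sum.inr c := Sum.isRight_iff.mp hxy.2
    refine ⟨?_, fun r hr => ⟨c, hF.symm _ _ hxy.1, ih.1 c rfl⟩⟩
    rintro d rfl j
    exact h.inv_mul_neg_of_right hN (hF.symm _ _ hxy.1) (ih.1 c rfl j)

theorem schur_pos (h : IsNetworkMatrix F Q N) (hN : N.PosDef)
    {u : Fin 3 → R} (hF : IsTripodNetwork u F) (i j : Fin 3) :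
    0 < (Q * N⁻¹ * Qᵀ) (u i) (u j) := by
  obtain ⟨c, hc, hneg⟩ := h.exists_adjacent_forall_inv_mul_neg hN hF i
  rw [Matrix.mul_assoc, Matrix.mul_apply]
  exact Finset.sum_pos' (fun d _ => mul_nonneg_of_nonpos_of_nonpos (h.left_nonpos _ _)
    (h.inv_mul_nonpos hN _ _)) ⟨c, Finset.mem_univ _,
    mul_pos_of_neg_of_neg (h.neg_left _ _ hc) (hneg j)⟩

theorem inv_mul_eq_zero (h : IsNetworkMatrix F Q N) {u : Fin 3 → R} (hF : IsTripodNetwork u F)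
    {r : R} (hr : r ∉ Set.range u) (c : C) : (N⁻¹ * Qᵀ) c r = 0 := by
  rw [Matrix.mul_apply]
  exact Finset.sum_eq_zero fun d _ => by
    rw [transpose_apply, h.left_eq_zero hF hr, mul_zero]

theorem schur_eq_zero (h : IsNetworkMatrix F Q N) {u : Fin 3 → R} (hF : IsTripodNetwork u F)
    {r s : R} (hrs : r ∉ Set.range u ∨ s ∉ Set.range u) : (Q * N⁻¹ * Qᵀ) r s = 0 := by
  rw [Matrix.mul_assoc, Matrix.mul_apply]
  refine Finset.sum_eq_zero fun d _ => ?_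
  rcases hrs with hr | hs
  · rw [h.left_eq_zero hF hr, zero_mul]
  · rw [h.inv_mul_eq_zero hF hs, mul_zero]

end IsNetworkMatrix

/-- The relation `E` on the left summand of `R ⊕ C`. -/
def leftRel {R C : Type*} (E : R → R → Prop) : R ⊕ C → R ⊕ C → Prop
  | Sum.inl r, Sum.inl s => E r s
  | _, _ => False

namespace IsNetworkMatrix

variable {R C : Type*} {F : R ⊕ C → R ⊕ C → Prop} {Q : Matrix R C ℝ} {N : Matrix C C ℝ}
  [Fintype R] [Fintype C] [DecidableEq C] {u : Fin 3 → R}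

theorem inv_mul_mul_apply (h : IsNetworkMatrix F Q N) (hF : IsTripodNetwork u F)
    (hu : Function.Injective u) (Y : Matrix R R ℝ) (c : C) (s : R) :
    (N⁻¹ * Qᵀ * Y) c s = ∑ j, (N⁻¹ * Qᵀ) c (u j) * Y (u j) s := by
  rw [Matrix.mul_apply]
  exact (Fintype.sum_of_injective u hu _ _
    (fun r hr => by rw [h.inv_mul_eq_zero hF hr, zero_mul]) fun j => rfl).symm

/-- Here `N⁻¹ Qᵀ Y` is, up to sign, the off-diagonal block of a test matrix. Its zero at a suitable
neighbour of `u i` is a relation with strictly negative coefficients between the two entries of `Y`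
joining `u i` to the other terminals. -/
theorem terminals_eq_zero (h : IsNetworkMatrix F Q N) (hN : N.PosDef) (hF : IsTripodNetwork u F)
    (hu : Function.Injective u) {Y : Matrix R R ℝ} (hY : Y.IsSymm) (hdiag : ∀ r, Y r r = 0)
    (hZ : ∀ c r, F (Sum.inl r) (Sum.inr c) → (N⁻¹ * Qᵀ * Y) c r = 0) (i j : Fin 3) :
    Y (u i) (u j) = 0 := by
  have key : ∀ i, ∃ g : Fin 3 → ℝ, (∀ j, g j < 0) ∧ ∑ j, g j * Y (u j) (u i) = 0 := by
    intro i
    obtain ⟨c, hc, hneg⟩ := h.exists_adjacent_forall_inv_mul_neg hN hF i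
    exact ⟨_, hneg, by rw [← h.inv_mul_mul_apply hF hu]; exact hZ _ _ hc⟩
  have h10 : Y (u 1) (u 0) = Y (u 0) (u 1) := hY.apply _ _
  have h20 : Y (u 2) (u 0) = Y (u 0) (u 2) := hY.apply _ _
  have h21 : Y (u 2) (u 1) = Y (u 1) (u 2) := hY.apply _ _
  obtain ⟨a, ha, ha'⟩ := key 0
  obtain ⟨b, hb, hb'⟩ := key 1
  obtain ⟨c, hc, hc'⟩ := key 2
  simp only [Fin.sum_univ_three, hdiag, h10, h20, h21, mul_zero, zero_add, add_zero] at ha' hb' hc'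
  have opp : ∀ {p q x y : ℝ}, p < 0 → q < 0 → p * x + q * y = 0 → 0 < x → y < 0 := by
    intro p q x y hp hq hpq hx
    by_contra hy
    nlinarith [mul_pos_of_neg_of_neg hp (neg_lt_zero.mpr hx), mul_nonneg (neg_pos.mpr hq).le
      (not_lt.mp hy)]
  have opp' : ∀ {p q x y : ℝ}, p < 0 → q < 0 → p * x + q * y = 0 → x < 0 → 0 < y := by
    intro p q x y hp hq hpq hx
    have := opp hp hq (x := -x) (y := -y) (by linarith) (by linarith)
    linarith
  -- A nonzero value would give both other entries the opposite sign, but the relation at `u 2`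
  -- forbids these two from having equal signs.
  have hx : Y (u 0) (u 1) = 0 := by
    rcases lt_trichotomy (Y (u 0) (u 1)) 0 with hneg | h0 | hpos
    · have h1 := opp' (ha 1) (ha 2) ha' hneg
      have h2 := opp' (hb 0) (hb 2) hb' hneg
      have h3 := opp (hc 0) (hc 1) hc' h1
      linarith
    · exact h0
    · have h1 := opp (ha 1) (ha 2) ha' hpos
      have h2 := opp (hb 0) (hb 2) hb' hpos
      have h3 := opp' (hc 0) (hc 1) hc' h1
      linarith
  have hy : Y (u 0) (u 2) = 0 := by
    rw [hx, mul_zero, zero_add] at ha'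
    exact (mul_eq_zero.mp ha').resolve_left (ha 2).ne
  have hz : Y (u 1) (u 2) = 0 := by
    rw [hx, mul_zero, zero_add] at hb'
    exact (mul_eq_zero.mp hb').resolve_left (hb 2).ne
  fin_cases i <;> fin_cases j <;> simp [hdiag, h10, h20, h21, hx, hy, hz]

end IsNetworkMatrix

/-! ### Transfer of the Strong Arnold Property -/

theorem Matrix.PosDef.eq_neg_inv_mul {R C D : Type*} [Fintype R] [Fintype C] [DecidableEq C]
    {N : Matrix C C ℝ} (hN : N.PosDef) {Q : Matrix R C ℝ} {T : Matrix R D ℝ} {U : Matrix C D ℝ}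
    (h : Qᵀ * T + N * U = 0) : U = -(N⁻¹ * Qᵀ * T) := by
  rw [Matrix.mul_assoc, eq_neg_of_add_eq_zero_left h, Matrix.mul_neg, neg_neg,
    ← Matrix.mul_assoc, hN.inv_mul_self, Matrix.one_mul]

/-- The block `Y` of a test matrix for the new network is annihilated by the common Schur complement
and vanishes between terminals. It therefore extends to a test matrix for the old network, so `Y =
0`, and the remaining blocks are linear images of `Y`. -/
theorem StrongArnold.of_schur_eq {R C C' : Type*} [Fintype R] [Fintype C] [DecidableEq C]
    [Fintype C'] [DecidableEq C'] {u : Fin 3 → R} (hu : Function.Injective u)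
    {E : R → R → Prop} {F : R ⊕ C → R ⊕ C → Prop} {F' : R ⊕ C' → R ⊕ C' → Prop}
    (hF : IsTripodNetwork u F) (hF' : IsTripodNetwork u F')
    {P P' : Matrix R R ℝ} {Q : Matrix R C ℝ} {N : Matrix C C ℝ} {Q' : Matrix R C' ℝ}
    {N' : Matrix C' C' ℝ} (h : IsNetworkMatrix F Q N) (h' : IsNetworkMatrix F' Q' N')
    (hN : N.PosDef) (hN' : N'.PosDef) (hS : P - Q * N⁻¹ * Qᵀ = P' - Q' * N'⁻¹ * Q'ᵀ)
    (hA : StrongArnold (fun x y => leftRel E x y ∨ F x y) (fromBlocks P Q Qᵀ N)) :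
    StrongArnold (fun x y => leftRel E x y ∨ F' x y) (fromBlocks P' Q' Q'ᵀ N') := by
  intro X hXs hX0 hAX
  obtain ⟨Y, Z₂, Z, W, rfl⟩ : ∃ Y Z₂ Z W, X = fromBlocks Y Z₂ Z W :=
    ⟨_, _, _, _, (fromBlocks_toBlocks X).symm⟩
  obtain ⟨hY, hZ, -, hW⟩ := (isSymm_fromBlocks_iff).mp hXs
  obtain rfl : Z₂ = Zᵀ := by rw [← hZ, transpose_transpose]
  rw [fromBlocks_multiply] at hAX
  have h11 : P' * Y + Q' * Z = 0 := by
    ext r s; exact congrFun (congrFun hAX (Sum.inl r)) (Sum.inl s)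
  have h21 : Q'ᵀ * Y + N' * Z = 0 := by
    ext r s; exact congrFun (congrFun hAX (Sum.inr r)) (Sum.inl s)
  have h22 : Q'ᵀ * Zᵀ + N' * W = 0 := by
    ext r s; exact congrFun (congrFun hAX (Sum.inr r)) (Sum.inr s)
  have hZY := hN'.eq_neg_inv_mul h21
  have hWZ := hN'.eq_neg_inv_mul h22
  have hdiag : ∀ r, Y r r = 0 := fun r => hX0 (Sum.inl r) (Sum.inl r) (Or.inl rfl)
  have hT := h'.terminals_eq_zero hN' hF' hu hY hdiag fun c r hcr => by
    have := hX0 (Sum.inr c) (Sum.inl r) (Or.inr (Or.inr (hF'.symm _ _ hcr)))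
    change Z c r = 0 at this
    rw [hZY, neg_apply, neg_eq_zero] at this
    exact this
  have hSY : (P - Q * N⁻¹ * Qᵀ) * Y = 0 := by
    rw [hS, Matrix.sub_mul, ← h11, hZY, Matrix.mul_neg, sub_eq_add_neg]
    simp only [Matrix.mul_assoc]
  have hPY : P * Y = Q * N⁻¹ * Qᵀ * Y := by
    rwa [Matrix.sub_mul, sub_eq_zero] at hSY
  have hGT : ∀ c i, (N⁻¹ * Qᵀ * Y) c (u i) = 0 := fun c i => by
    rw [h.inv_mul_mul_apply hF hu]
    exact Finset.sum_eq_zero fun j _ => by rw [hT, mul_zero]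
  have hGYQ : N⁻¹ * Qᵀ * Y * Q = 0 := by
    ext c d
    rw [Matrix.mul_apply]
    refine Finset.sum_eq_zero fun r _ => ?_
    by_cases hr : r ∈ Set.range u
    · obtain ⟨i, rfl⟩ := hr
      rw [hGT, zero_mul]
    · rw [h.left_eq_zero hF hr, mul_zero]
  have hQYQ : Qᵀ * Y * Q = 0 := by
    have := congrArg (N * ·) hGYQ
    simpa only [← Matrix.mul_assoc, hN.self_mul_inv, Matrix.one_mul, Matrix.mul_zero] using this
  have hGt : (N⁻¹ * Qᵀ * Y)ᵀ = Y * Q * N⁻¹ := by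
    rw [transpose_mul, transpose_mul, transpose_transpose, hY.eq, hN.inv_isSymm.eq,
      Matrix.mul_assoc]
  -- The off-diagonal block is dictated by the lower block row. The corner block may be 0 because
  -- `Qᵀ Y Q = 0`: `Q` is supported on terminal rows, where `Y` vanishes.
  have hX := hA (fromBlocks Y (-(N⁻¹ * Qᵀ * Y)ᵀ) (-(N⁻¹ * Qᵀ * Y)) 0)
    (isSymm_fromBlocks_iff.mpr ⟨hY, by simp, by simp, by simp⟩) ?_ ?_
  · have hY0 : Y = 0 := by
      ext r s; exact congrFun (congrFun hX (Sum.inl r)) (Sum.inl s)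
    have hZ0 : Z = 0 := by rw [hZY, hY0, Matrix.mul_zero, neg_zero]
    rw [hWZ, hZ0, hY0]
    simp
  · have hGz : ∀ r c, F (Sum.inl r) (Sum.inr c) → (N⁻¹ * Qᵀ * Y) c r = 0 := by
      intro r c hrc
      obtain ⟨i, rfl⟩ := hF.mem_range _ _ hrc
      exact hGT c i
    rintro (r | c) (s | d) hrs
    · change Y r s = 0
      rcases hrs with hrs | hrs | hrs
      · cases hrs
        exact hdiag r
      · exact hX0 (Sum.inl r) (Sum.inl s) (Or.inr (Or.inl hrs))
      · obtain ⟨i, rfl⟩ := hF.mem_range _ _ hrs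
        obtain ⟨j, rfl⟩ := hF.mem_range _ _ (hF.symm _ _ hrs)
        exact hT i j
    · rcases hrs with hrs | hrs | hrs
      · cases hrs
      · exact hrs.elim
      · change (-(N⁻¹ * Qᵀ * Y)ᵀ) r d = 0
        rw [neg_apply, transpose_apply, hGz r d hrs, neg_zero]
    · rcases hrs with hrs | hrs | hrs
      · cases hrs
      · exact hrs.elim
      · change (-(N⁻¹ * Qᵀ * Y)) c s = 0
        rw [neg_apply, hGz s c (hF.symm _ _ hrs), neg_zero]
    · rfl
  · rw [fromBlocks_multiply, hGt, ← fromBlocks_zero]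
    congr 1
    · rw [hPY, Matrix.mul_neg]
      simp only [Matrix.mul_assoc, add_neg_cancel]
    · rw [Matrix.mul_neg, Matrix.mul_zero, add_zero, ← Matrix.mul_assoc, ← Matrix.mul_assoc, hPY,
        Matrix.mul_assoc Q, Matrix.mul_assoc Q, Matrix.mul_assoc Q, hGYQ]
      simp
    · rw [Matrix.mul_neg, ← Matrix.mul_assoc, ← Matrix.mul_assoc, hN.self_mul_inv, Matrix.one_mul,
        add_neg_cancel]
    · rw [Matrix.mul_neg, Matrix.mul_zero, add_zero, ← Matrix.mul_assoc, ← Matrix.mul_assoc, hQYQ]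
      simp

/-! ### Attaining a prescribed response -/

theorem exists_scaling (q : Fin 3 → Fin 3 → ℝ) (hsymm : ∀ i j, q i j = q j i)
    (hpos : ∀ i j, i ≠ j → 0 < q i j) :
    ∃ d : Fin 3 → ℝ, (∀ i, 0 < d i) ∧ ∀ i j, i ≠ j → d i * d j = q i j := by
  have h01 := hpos 0 1 (by decide)
  have h02 := hpos 0 2 (by decide)
  have h12 := hpos 1 2 (by decide)
  -- The three equations force `(d 0)² = q 0 1 * q 0 2 / q 1 2`; the other two factors follow by
  -- division.
  obtain ⟨s, hs⟩ : ∃ s, s = √(q 0 1 * q 0 2 / q 1 2) := ⟨_, rfl⟩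
  have hs0 : 0 < s := by rw [hs]; positivity
  have hss : s * s = q 0 1 * q 0 2 / q 1 2 := by rw [hs]; exact Real.mul_self_sqrt (by positivity)
  have e01 : s * (q 0 1 / s) = q 0 1 := mul_div_cancel₀ _ hs0.ne'
  have e02 : s * (q 0 2 / s) = q 0 2 := mul_div_cancel₀ _ hs0.ne'
  have e12 : q 0 1 / s * (q 0 2 / s) = q 1 2 := by
    rw [div_mul_div_comm, hss]
    field_simp
  refine ⟨![s, q 0 1 / s, q 0 2 / s], ?_, ?_⟩
  · intro i
    fin_cases i
    · exact hs0
    · exact div_pos h01 hs0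
    · exact div_pos h02 hs0
  · intro i j hij
    fin_cases i <;> fin_cases j
    · exact absurd rfl hij
    · exact e01
    · exact e02
    · exact (mul_comm _ _).trans (e01.trans (hsymm _ _))
    · exact absurd rfl hij
    · exact e12
    · exact (mul_comm _ _).trans (e02.trans (hsymm _ _))
    · exact (mul_comm _ _).trans (e12.trans (hsymm _ _))
    · exact absurd rfl hij

/-- Every prescribed positive response between the terminals is attained by some network matrix. -/
theorem IsTripodNetwork.exists_networkMatrix {R C : Type*} [Fintype R] [Fintype C]
    [DecidableEq C] {u : Fin 3 → R} (hu : Function.Injective u) {F : R ⊕ C → R ⊕ C → Prop}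
    (hF : IsTripodNetwork u F) (t : Fin 3 → Fin 3 → ℝ) (htsymm : ∀ i j, t i j = t j i)
    (htpos : ∀ i j, i ≠ j → 0 < t i j) :
    ∃ (Q : Matrix R C ℝ) (N : Matrix C C ℝ), IsNetworkMatrix F Q N ∧ N.PosDef ∧
      ∀ i j, i ≠ j → ∃ p, t i j = (Q * N⁻¹ * Qᵀ) (u i) (u j) - p ∧
        (F (Sum.inl (u i)) (Sum.inl (u j)) → p < 0) ∧
        (¬ F (Sum.inl (u i)) (Sum.inl (u j)) → p = 0) := by
  classical
  obtain ⟨L, hL⟩ : ∃ L, L = (SimpleGraph.fromRel F).lapMatrix ℝ := ⟨_, rfl⟩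
  have hL1 : ∀ x y, x ≠ y → F x y → L x y = -1 := fun x y hxy h => by
    simp [hL, SimpleGraph.lapMatrix, SimpleGraph.degMatrix, SimpleGraph.adjMatrix, hxy, h]
  have hL0 : ∀ x y, x ≠ y → ¬ F x y → L x y = 0 := fun x y hxy h => by
    have h' : ¬ F y x := fun h' => h (hF.symm _ _ h')
    simp [hL, SimpleGraph.lapMatrix, SimpleGraph.degMatrix, SimpleGraph.adjMatrix, hxy, h, h']
  have hLsymm : ∀ x y, L x y = L y x := fun x y => by
    rw [hL]; exact (SimpleGraph.isSymm_lapMatrix (R := ℝ) (SimpleGraph.fromRel F)).apply y x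
  -- A Laplacian block has the right signs; adding the identity makes it positive definite even at
  -- isolated vertices.
  obtain ⟨N, hNdef⟩ : ∃ N : Matrix C C ℝ, N = L.submatrix Sum.inr Sum.inr + 1 := ⟨_, rfl⟩
  obtain ⟨Q₀, hQ₀⟩ : ∃ Q₀ : Matrix R C ℝ, Q₀ = L.submatrix Sum.inl Sum.inr := ⟨_, rfl⟩
  have hN : N.PosDef := by
    rw [hNdef, hL]
    exact PosDef.posSemidef_add
      (PosSemidef.submatrix (SimpleGraph.posSemidef_lapMatrix ℝ _) _) PosDef.one
  have hNet₀ : IsNetworkMatrix F Q₀ N := by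
    refine ⟨fun r c h => ?_, fun r c h => ?_, fun c d hcd h => ?_, fun c d hcd h => ?_⟩
    · rw [hQ₀, submatrix_apply, hL1 _ _ (by simp) h]; norm_num
    · rw [hQ₀, submatrix_apply, hL0 _ _ (by simp) h]
    · rw [hNdef, Matrix.add_apply, submatrix_apply, one_apply_ne hcd, hL1 _ _ (by simpa using hcd) h]
      norm_num
    · rw [hNdef, Matrix.add_apply, submatrix_apply, one_apply_ne hcd, hL0 _ _ (by simpa using hcd) h,
        add_zero]
  obtain ⟨K, hK⟩ : ∃ K, K = Q₀ * N⁻¹ * Q₀ᵀ := ⟨_, rfl⟩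
  have hKsymm : ∀ r s, K r s = K s r := by
    have : Kᵀ = K := by rw [hK, hN.transpose_schur]
    exact fun r s => congrFun (congrFun this s) r
  -- The total coupling of two terminals: the response through `C` together with a direct link, if
  -- `F` has one. Scaling the terminals multiplies both contributions by `d i * d j`.
  obtain ⟨a, ha⟩ : ∃ a : Fin 3 → Fin 3 → ℝ,
      ∀ i j, a i j = K (u i) (u j) - L (Sum.inl (u i)) (Sum.inl (u j)) := ⟨_, fun _ _ => rfl⟩
  have hapos : ∀ i j, i ≠ j → 0 < a i j := fun i j hij => by
    have h1 : 0 < K (u i) (u j) := by rw [hK]; exact hNet₀.schur_pos hN hF i j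
    have hne : (Sum.inl (u i) : R ⊕ C) ≠ Sum.inl (u j) := by simpa using hu.ne hij
    rw [ha]
    by_cases h : F (Sum.inl (u i)) (Sum.inl (u j))
    · rw [hL1 _ _ hne h]; linarith
    · rw [hL0 _ _ hne h]; linarith
  obtain ⟨d, hd, hdq⟩ := exists_scaling (fun i j => t i j / a i j)
    (fun i j => by simp only [htsymm i j, ha, hKsymm (u i), hLsymm (Sum.inl (u i))])
    (fun i j hij => div_pos (htpos i j hij) (hapos i j hij))
  obtain ⟨e, he⟩ : ∃ e : R → ℝ, e = Function.extend u d 1 := ⟨_, rfl⟩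
  have heu : ∀ i, e (u i) = d i := fun i => by rw [he, hu.extend_apply]
  have hepos : ∀ r, 0 < e r := fun r => by
    by_cases hr : ∃ i, u i = r
    · obtain ⟨i, rfl⟩ := hr
      rw [heu]; exact hd i
    · rw [he, Function.extend_apply' _ _ _ hr]; exact one_pos
  refine ⟨diagonal e * Q₀, N, ?_, hN, fun i j hij => ?_⟩
  · refine ⟨fun r c h => ?_, fun r c h => ?_, hNet₀.neg_right, hNet₀.zero_right⟩
    · rw [diagonal_mul]
      exact mul_neg_of_pos_of_neg (hepos r) (hNet₀.neg_left r c h)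
    · rw [diagonal_mul, hNet₀.zero_left r c h, mul_zero]
  · have hK' : (diagonal e * Q₀ * N⁻¹ * (diagonal e * Q₀)ᵀ) (u i) (u j) =
        d i * d j * K (u i) (u j) := by
      rw [transpose_mul, diagonal_transpose, ← Matrix.mul_assoc, mul_diagonal, Matrix.mul_assoc,
        Matrix.mul_assoc, diagonal_mul, heu, heu, ← Matrix.mul_assoc, ← hK]
      ring
    have hne : (Sum.inl (u i) : R ⊕ C) ≠ Sum.inl (u j) := by simpa using hu.ne hij
    refine ⟨d i * d j * L (Sum.inl (u i)) (Sum.inl (u j)), ?_, fun h => ?_, fun h => ?_⟩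
    · rw [hK', ← mul_sub, ← ha, hdq i j hij, div_mul_cancel₀ _ (hapos i j hij).ne']
    · rw [hL1 _ _ hne h]
      have := mul_pos (hd i) (hd j)
      linarith
    · rw [hL0 _ _ hne h, mul_zero]

/-- The off-diagonal entries of `A` are negative on the pairs related by `Ev` only, positive on the
pairs related by `Od` only, zero on the pairs related by neither. -/
structure FitsPattern {V : Type*} (Ev Od : V → V → Prop) (A : Matrix V V ℝ) : Prop where
  symm : A.IsSymm
  neg : ∀ i j, i ≠ j → Ev i j → ¬ Od i j → A i j < 0
  pos : ∀ i j, i ≠ j → Od i j → ¬ Ev i j → 0 < A i j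
  zero : ∀ i j, i ≠ j → ¬ Ev i j → ¬ Od i j → A i j = 0

/-! ### Positive definiteness of the network block -/

section Pattern

variable {R C : Type*} {u : Fin 3 → R} {Ev Od : R → R → Prop}
  {F : R ⊕ C → R ⊕ C → Prop} {P : Matrix R R ℝ} {Q : Matrix R C ℝ} {N : Matrix C C ℝ}

theorem FitsPattern.isNetworkMatrix
    (hA : FitsPattern (fun x y => leftRel Ev x y ∨ F x y) (leftRel Od) (fromBlocks P Q Qᵀ N)) :
    IsNetworkMatrix F Q N where
  neg_left r c h := hA.neg (Sum.inl r) (Sum.inr c) (by simp) (Or.inr h) id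
  zero_left r c h := hA.zero (Sum.inl r) (Sum.inr c) (by simp)
    (by rintro (h' | h'); exacts [h', h h']) id
  neg_right c d hcd h := hA.neg (Sum.inr c) (Sum.inr d) (by simpa using hcd) (Or.inr h) id
  zero_right c d hcd h := hA.zero (Sum.inr c) (Sum.inr d) (by simpa using hcd)
    (by rintro (h' | h'); exacts [h', h h']) id

/-- A kernel vector of `N` may be taken nonnegative, and extended by 0 it lies in the kernel of the
whole matrix. Its support is closed under adjacency and never reaches `R`, so it contains only
isolated vertices. An isolated vertex in the support gives a zero column, which contradicts the
Strong Arnold Property when the nullity is at least 2. -/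
theorem FitsPattern.posDef_right [Fintype R] [Fintype C] (hF : IsTripodNetwork u F)
    (hA : FitsPattern (fun x y => leftRel Ev x y ∨ F x y) (leftRel Od) (fromBlocks P Q Qᵀ N))
    (hpsd : (fromBlocks P Q Qᵀ N).PosSemidef)
    (hsap : StrongArnold (fun x y => (leftRel Ev x y ∨ F x y) ∨ leftRel Od x y)
      (fromBlocks P Q Qᵀ N))
    (hk : 2 ≤ Module.finrank ℝ (LinearMap.ker (fromBlocks P Q Qᵀ N).mulVecLin)) : N.PosDef := by
  classical
  have hnet := hA.isNetworkMatrix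
  have hN : N.PosSemidef := hpsd.submatrix Sum.inr
  by_contra hnot
  obtain ⟨z, hz0, hz⟩ : ∃ z, z ≠ 0 ∧ N *ᵥ z = 0 := by
    by_contra! hcon
    refine hnot (PosDef.of_dotProduct_mulVec_pos hN.isHermitian fun x hx => ?_)
    refine lt_of_le_of_ne (hN.dotProduct_mulVec_nonneg x) fun h0 => hcon x hx ?_
    exact hN.dotProduct_mulVec_zero_iff x |>.mp h0.symm
  obtain ⟨y, hy⟩ : ∃ y : C → ℝ, y = fun i => |z i| := ⟨_, rfl⟩
  have hy0 : ∀ c, 0 ≤ y c := fun c => by rw [hy]; exact abs_nonneg _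
  have hNy : N *ᵥ y = 0 := by rw [hy]; exact mulVec_abs_eq_zero hN hnet.right_nonpos hz
  have hAy : fromBlocks P Q Qᵀ N *ᵥ Sum.elim 0 y = 0 := by
    rw [← hpsd.dotProduct_mulVec_zero_iff, star_trivial, fromBlocks_mulVec, sumElim_dotProduct_sumElim]
    simp [hNy]
  have hQy : ∀ r, ∑ c, Q r c * y c = 0 := fun r => by
    have := congrFun hAy (Sum.inl r)
    rw [fromBlocks_mulVec] at this
    simpa [mulVec, dotProduct] using this
  obtain ⟨c, hc⟩ : ∃ c, 0 < y c := by
    obtain ⟨c, hc⟩ := Function.ne_iff.mp hz0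
    exact ⟨c, by rw [hy]; exact abs_pos.mpr hc⟩
  rcases hF.grounded c with ⟨r, hr⟩ | hiso
  · suffices ∀ x, ReflTransGen F (Sum.inr c) x → ∃ d, x = Sum.inr d ∧ 0 < y d by
      obtain ⟨d, hd, -⟩ := this _ hr
      cases hd
    intro x hx
    induction hx with
    | refl => exact ⟨c, rfl, hc⟩
    | @tail x x' _ hxx' ih =>
      obtain ⟨d, rfl, hd⟩ := ih
      rcases x' with s | d'
      · have h1 := hQy s
        rw [Finset.sum_eq_zero_iff_of_nonpos fun c _ =>
          mul_nonpos_of_nonpos_of_nonneg (hnet.left_nonpos s c) (hy0 c)] at h1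
        exact absurd (h1 d (Finset.mem_univ _))
          (mul_neg_of_neg_of_pos (hnet.neg_left s d (hF.symm _ _ hxx')) hd).ne
      · refine ⟨d', rfl, lt_of_le_of_ne (hy0 d') fun h0 => ?_⟩
        have hne : d' ≠ d := by rintro rfl; exact hd.ne h0
        have h1 : ∑ e, N d' e * y e = 0 := congrFun hNy d'
        rw [Finset.sum_eq_zero_iff_of_nonpos fun e _ => ?_] at h1
        · exact absurd (h1 d (Finset.mem_univ _))
            (mul_neg_of_neg_of_pos (hnet.neg_right d' d hne (hF.symm _ _ hxx')) hd).ne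
        · by_cases he : d' = e
          · rw [← he, ← h0, mul_zero]
          · exact mul_nonpos_of_nonpos_of_nonneg (hnet.right_nonpos d' e he) (hy0 e)
  · have hiso' : ∀ x, ¬ F x (Sum.inr c) := fun x h => hiso x (hF.symm _ _ h)
    have hcc : N c c = 0 := by
      have h1 : ∑ e, N c e * y e = 0 := congrFun hNy c
      rw [Finset.sum_eq_single c (fun e _ he => by
        rw [hnet.zero_right c e he.symm (hiso _), zero_mul]) (by simp)] at h1
      exact (mul_eq_zero.mp h1).resolve_right hc.ne'
    have hcol : ∀ x, fromBlocks P Q Qᵀ N x (Sum.inr c) = 0 := by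
      rintro (r | d)
      · exact hnet.zero_left r c (hiso' _)
      · by_cases hd : d = c
        · rw [hd]; exact hcc
        · exact hnet.zero_right d c hd (hiso' _)
    -- The kernel has dimension at least 2, so one linear condition leaves a nonzero vector. With
    -- `b` the unit vector at `c`, the symmetrized product of `b` and `v` is a forbidden test
    -- matrix.
    obtain ⟨v, hv, hv0, hvc⟩ : ∃ v, fromBlocks P Q Qᵀ N *ᵥ v = 0 ∧ v ≠ 0 ∧ v (Sum.inr c) = 0 := by
      let f : LinearMap.ker (fromBlocks P Q Qᵀ N).mulVecLin →ₗ[ℝ] ℝ :=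
        (LinearMap.proj (Sum.inr c)).comp (Submodule.subtype _)
      have hne : LinearMap.ker f ≠ ⊥ :=
        LinearMap.ker_ne_bot_of_finrank_lt (by rw [Module.finrank_self]; omega)
      obtain ⟨⟨v, hv⟩, hvf, hv0⟩ := (Submodule.ne_bot_iff _).mp hne
      exact ⟨v, hv, fun h => hv0 (Subtype.ext h), hvf⟩
    obtain ⟨b, hb⟩ : ∃ b : R ⊕ C → ℝ, b = Pi.single (Sum.inr c) 1 := ⟨_, rfl⟩
    have hb1 : b (Sum.inr c) = 1 := by rw [hb, Pi.single_eq_same]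
    have hb0 : ∀ x, x ≠ Sum.inr c → b x = 0 := fun x hx => by rw [hb, Pi.single_eq_of_ne hx]
    have hAb : fromBlocks P Q Qᵀ N *ᵥ b = 0 := by
      ext x
      rw [hb, mulVec_single_one]
      exact hcol x
    have hX := hsap (vecMulVec b v + vecMulVec v b) ?_ ?_ ?_
    · refine hv0 (funext fun x => ?_)
      have := congrFun (congrFun hX (Sum.inr c)) x
      simpa [vecMulVec_apply, hb1, hvc] using this
    · ext x x'
      simp only [transpose_apply, Matrix.add_apply, vecMulVec_apply]
      ring
    · intro x x' hxx'
      simp only [Matrix.add_apply, vecMulVec_apply]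
      by_cases hx : x = Sum.inr c
      · subst hx
        rcases hxx' with rfl | (h | h) | h
        · rw [hvc]; ring
        · exact h.elim
        · exact (hiso _ h).elim
        · exact h.elim
      · by_cases hx' : x' = Sum.inr c
        · subst hx'
          rcases hxx' with rfl | (h | h) | h
          · rw [hvc]; ring
          · rcases x with r | r <;> exact h.elim
          · exact (hiso' _ h).elim
          · rcases x with r | r <;> exact h.elim
        · rw [hb0 x hx, hb0 x' hx']; ring
    · rw [Matrix.mul_add, mul_vecMulVec, mul_vecMulVec, hAb, hv]
      simp

end Pattern

/-! ### Exchanging one network for another -/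

/-- Some positive semidefinite matrix fitting the pattern `Ev`, `Od` and having the Strong Arnold
Property has nullity `k`. -/
def RealizesNullity {V : Type*} [Fintype V] (Ev Od : V → V → Prop) (k : ℕ) : Prop :=
  ∃ A : Matrix V V ℝ, FitsPattern Ev Od A ∧ A.PosSemidef ∧
    StrongArnold (fun x y => Ev x y ∨ Od x y) A ∧
    Module.finrank ℝ (LinearMap.ker A.mulVecLin) = k

theorem StrongArnold.congr {V : Type*} [Fintype V] {adj adj' : V → V → Prop} {A : Matrix V V ℝ}
    (h : StrongArnold adj A) (hadj : ∀ x y, adj x y → adj' x y) : StrongArnold adj' A :=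
  fun X hX hX0 hAX => h X hX (fun i j hij => hX0 i j (hij.imp_right (hadj i j))) hAX

/-- Splitting off from an entry a nonpositive part so that the rest has the sign prescribed when the
relation `f` is disregarded. -/
theorem exists_nonpos_split {e o f : Prop} {x : ℝ} (hneg : e ∨ f → ¬ o → x < 0)
    (hzero : ¬ (e ∨ f) → ¬ o → x = 0) :
    ∃ p ≤ 0, (e → ¬ o → x - p < 0) ∧ (o → ¬ e → 0 < x - p) ∧ (¬ e → ¬ o → x - p = 0) := by
  by_cases ho : o
  -- With `o` present, `x` may have any sign because of `f`; a part this negative makes the rest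
  -- positive regardless.
  · refine ⟨-(|x| + 1), by linarith [abs_nonneg x], fun _ h => absurd ho h, fun _ _ => ?_,
      fun _ h => absurd ho h⟩
    linarith [neg_abs_le x]
  · by_cases he : e
    · exact ⟨0, le_rfl, fun _ _ => by linarith [hneg (Or.inl he) ho], fun h => absurd h ho,
        fun h => absurd he h⟩
    · refine ⟨x, ?_, fun h => absurd h he, fun h => absurd h ho, fun _ _ => sub_self x⟩
      by_cases hf : f
      · exact (hneg (Or.inr hf) ho).le
      · exact (hzero (by tauto) ho).le

/-- A tripod network may be replaced by any other one on the same terminals. -/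
theorem RealizesNullity.replace_network {R C C' : Type*} [Fintype R] [Fintype C] [Fintype C']
    {u : Fin 3 → R} (hu : Function.Injective u) {Ev Od : R → R → Prop}
    (hEv : ∀ r s, Ev r s → Ev s r) (hOd : ∀ r s, Od r s → Od s r)
    {F : R ⊕ C → R ⊕ C → Prop} {F' : R ⊕ C' → R ⊕ C' → Prop}
    (hF : IsTripodNetwork u F) (hF' : IsTripodNetwork u F') {k : ℕ} (hk : 2 ≤ k)
    (h : RealizesNullity (fun x y => leftRel Ev x y ∨ F x y) (leftRel Od) k) :
    RealizesNullity (fun x y => leftRel Ev x y ∨ F' x y) (leftRel Od) k := by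
  classical
  obtain ⟨A, hA, hpsd, hsap, rfl⟩ := h
  obtain ⟨P, Q, Q₂, N, rfl⟩ : ∃ P Q Q₂ N, A = fromBlocks P Q Q₂ N :=
    ⟨_, _, _, _, (fromBlocks_toBlocks A).symm⟩
  obtain ⟨hP, rfl, -, -⟩ := isSymm_fromBlocks_iff.mp hA.symm
  have hnet := hA.isNetworkMatrix
  have hN := hA.posDef_right hF hpsd hsap hk
  obtain ⟨K, hK⟩ : ∃ K, K = Q * N⁻¹ * Qᵀ := ⟨_, rfl⟩
  have hKs : Kᵀ = K := by rw [hK, hN.transpose_schur]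
  have hsplit : ∀ i j, ∃ p ≤ 0, (i ≠ j → (Ev (u i) (u j) → ¬ Od (u i) (u j) →
      P (u i) (u j) - p < 0) ∧ (Od (u i) (u j) → ¬ Ev (u i) (u j) → 0 < P (u i) (u j) - p) ∧
      (¬ Ev (u i) (u j) → ¬ Od (u i) (u j) → P (u i) (u j) - p = 0)) := by
    intro i j
    by_cases hij : i = j
    · exact ⟨0, le_rfl, fun h => absurd hij h⟩
    have hne : (Sum.inl (u i) : R ⊕ C) ≠ Sum.inl (u j) := by simpa using hu.ne hij
    obtain ⟨p, hp, h⟩ := exists_nonpos_split (e := Ev (u i) (u j)) (o := Od (u i) (u j))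
      (f := F (Sum.inl (u i)) (Sum.inl (u j))) (hA.neg _ _ hne) (hA.zero _ _ hne)
    exact ⟨p, hp, fun _ => h⟩
  choose p₀ hp₀ hp₀' using hsplit
  -- The splittings were chosen independently for `(i, j)` and `(j, i)`; reading them off the
  -- ordered pair makes them symmetric.
  obtain ⟨p, hp⟩ : ∃ p : Fin 3 → Fin 3 → ℝ, p = fun i j => p₀ (min i j) (max i j) := ⟨_, rfl⟩
  have hpsymm : ∀ i j, p i j = p j i := fun i j => by rw [hp]; simp only [min_comm, max_comm]
  have hpnonpos : ∀ i j, p i j ≤ 0 := fun i j => by rw [hp]; exact hp₀ _ _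
  have hPs : ∀ r s, P r s = P s r := fun r s => hP.apply s r
  have hpsplit : ∀ i j, i ≠ j → (Ev (u i) (u j) → ¬ Od (u i) (u j) →
      P (u i) (u j) - p i j < 0) ∧ (Od (u i) (u j) → ¬ Ev (u i) (u j) → 0 < P (u i) (u j) - p i j) ∧
      (¬ Ev (u i) (u j) → ¬ Od (u i) (u j) → P (u i) (u j) - p i j = 0) := by
    intro i j hij
    rw [hp]
    rcases lt_or_gt_of_ne hij with h | h
    · simpa only [min_eq_left h.le, max_eq_right h.le] using hp₀' i j hij
    · have hE : Ev (u i) (u j) ↔ Ev (u j) (u i) := ⟨hEv _ _, hEv _ _⟩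
      have hO : Od (u i) (u j) ↔ Od (u j) (u i) := ⟨hOd _ _, hOd _ _⟩
      rw [hE, hO, hPs]
      simpa only [min_eq_right h.le, max_eq_left h.le] using hp₀' j i hij.symm
  -- The share `p` of direct `F`-links is counted with the old network. The new one must supply the
  -- total coupling `K - p`, positive since `K > 0` and `p ≤ 0`.
  obtain ⟨Q', N', hnet', hN', ht⟩ := hF'.exists_networkMatrix hu
    (fun i j => K (u i) (u j) - p i j)
    (fun i j => by rw [hpsymm i j, ← transpose_apply K, hKs])
    (fun i j hij => by
      have : 0 < K (u i) (u j) := by rw [hK]; exact hnet.schur_pos hN hF i j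
      linarith [hpnonpos i j])
  obtain ⟨K', hK'⟩ : ∃ K', K' = Q' * N'⁻¹ * Q'ᵀ := ⟨_, rfl⟩
  have hK's : K'ᵀ = K' := by rw [hK', hN'.transpose_schur]
  have hS : P - Q * N⁻¹ * Qᵀ = (P - K + K') - Q' * N'⁻¹ * Q'ᵀ := by
    rw [← hK, ← hK', add_sub_cancel_right]
  have hP' : (P - K + K').IsSymm := by
    rw [IsSymm, transpose_add, transpose_sub, hP.eq, hKs, hK's]
  have hout : ∀ r s, r ∉ Set.range u ∨ s ∉ Set.range u → (P - K + K') r s = P r s := by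
    intro r s hrs
    rw [Matrix.add_apply, Matrix.sub_apply, hK, hK', hnet.schur_eq_zero hF hrs,
      hnet'.schur_eq_zero hF' hrs, sub_zero, add_zero]
  have hFout : ∀ r s, r ∉ Set.range u ∨ s ∉ Set.range u → ¬ F (Sum.inl r) (Sum.inl s) := by
    rintro r s (hr | hs) h
    · exact hr (hF.mem_range _ _ h)
    · exact hs (hF.mem_range _ _ (hF.symm _ _ h))
  have hF'out : ∀ r s, r ∉ Set.range u ∨ s ∉ Set.range u → ¬ F' (Sum.inl r) (Sum.inl s) := by
    rintro r s (hr | hs) h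
    · exact hr (hF'.mem_range _ _ h)
    · exact hs (hF'.mem_range _ _ (hF'.symm _ _ h))
  have hin : ∀ r s, r ≠ s → (∃ i j, u i = r ∧ u j = s ∧ i ≠ j) ∨
      (r ∉ Set.range u ∨ s ∉ Set.range u) := by
    intro r s hrs
    by_contra! hcon
    obtain ⟨h, ⟨i, rfl⟩, ⟨j, rfl⟩⟩ := hcon
    exact hrs (by rw [h i j rfl rfl])
  -- Adjacency is regrouped so that all links not in the network form one relation on `R`.
  have hsapNew := hsap.congr (adj' := fun x y => leftRel (fun r s => Ev r s ∨ Od r s) x y ∨ F x y)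
    (by rintro (r | c) (s | d) ((h | h) | h) <;> first
      | exact Or.inr h
      | exact Or.inl (Or.inl h)
      | exact Or.inl (Or.inr h)
      | exact h.elim)
  have hterm : ∀ i j, i ≠ j → ∃ q, (P - K + K') (u i) (u j) = (P (u i) (u j) - p i j) + q ∧
      (F' (Sum.inl (u i)) (Sum.inl (u j)) → q < 0) ∧
      (¬ F' (Sum.inl (u i)) (Sum.inl (u j)) → q = 0) := by
    intro i j hij
    obtain ⟨q, hq, h⟩ := ht i j hij
    refine ⟨q, ?_, h⟩
    rw [Matrix.add_apply, Matrix.sub_apply]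
    rw [← hK'] at hq
    linarith
  refine ⟨fromBlocks (P - K + K') Q' Q'ᵀ N', ?_, ?_, ?_, ?_⟩
  · refine ⟨isSymm_fromBlocks_iff.mpr ⟨hP', rfl, transpose_transpose _, hN'.isSymm⟩, ?_, ?_, ?_⟩
    · rintro (r | c) (s | d) hne hE hO
      · have hne' : r ≠ s := fun h => hne (by rw [h])
        rw [fromBlocks_apply₁₁]
        rcases hin r s hne' with ⟨i, j, rfl, rfl, hij⟩ | hrs
        · obtain ⟨q, hq, hq1, hq0⟩ := hterm i j hij
          obtain ⟨h1, -, h3⟩ := hpsplit i j hij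
          rw [hq]
          by_cases hE1 : Ev (u i) (u j)
          · have := h1 hE1 hO
            by_cases hf : F' (Sum.inl (u i)) (Sum.inl (u j))
            · linarith [hq1 hf]
            · linarith [hq0 hf]
          · linarith [h3 hE1 hO, hq1 (hE.resolve_left hE1)]
        · rw [hout r s hrs]
          exact hA.neg (Sum.inl r) (Sum.inl s) (by simpa using hne')
            (Or.inl (hE.resolve_right (hF'out r s hrs))) hO
      · exact hnet'.neg_left r d (hE.resolve_left id)
      · exact hnet'.neg_left s c (hF'.symm _ _ (hE.resolve_left id))
      · exact hnet'.neg_right c d (fun h => hne (by rw [h])) (hE.resolve_left id)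
    · rintro (r | c) (s | d) hne hO hE
      · have hne' : r ≠ s := fun h => hne (by rw [h])
        rw [fromBlocks_apply₁₁]
        rcases hin r s hne' with ⟨i, j, rfl, rfl, hij⟩ | hrs
        · obtain ⟨q, hq, -, hq0⟩ := hterm i j hij
          rw [hq, hq0 fun h => hE (Or.inr h), add_zero]
          exact (hpsplit i j hij).2.1 hO fun h => hE (Or.inl h)
        · rw [hout r s hrs]
          exact hA.pos (Sum.inl r) (Sum.inl s) (by simpa using hne') hO
            (not_or.mpr ⟨fun h => hE (Or.inl h), hFout r s hrs⟩)
      · exact hO.elim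
      · exact hO.elim
      · exact hO.elim
    · rintro (r | c) (s | d) hne hE hO
      · have hne' : r ≠ s := fun h => hne (by rw [h])
        rw [fromBlocks_apply₁₁]
        rcases hin r s hne' with ⟨i, j, rfl, rfl, hij⟩ | hrs
        · obtain ⟨q, hq, -, hq0⟩ := hterm i j hij
          rw [hq, hq0 fun h => hE (Or.inr h), add_zero]
          exact (hpsplit i j hij).2.2 (fun h => hE (Or.inl h)) hO
        · rw [hout r s hrs]
          exact hA.zero (Sum.inl r) (Sum.inl s) (by simpa using hne')
            (not_or.mpr ⟨fun h => hE (Or.inl h), hFout r s hrs⟩) hO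
      · exact hnet'.zero_left r d fun h => hE (Or.inr h)
      · exact hnet'.zero_left s c fun h => hE (Or.inr (hF'.symm _ _ h))
      · exact hnet'.zero_right c d (fun h => hne (by rw [h])) fun h => hE (Or.inr h)
  · rw [hN'.posSemidef_fromBlocks_iff, ← hS, ← hN.posSemidef_fromBlocks_iff]
    exact hpsd
  · refine (StrongArnold.of_schur_eq hu hF hF' hnet hnet' hN hN' hS hsapNew).congr ?_
    rintro (r | c) (s | d) (h | h)
    · exact h.elim (fun h => Or.inl (Or.inl h)) Or.inr
    all_goals first | exact Or.inl (Or.inr h) | exact h.elim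
  · rw [hN'.finrank_ker_fromBlocks, ← hS, ← hN.finrank_ker_fromBlocks]

/-! ### Switching along a cut -/

theorem Matrix.finrank_ker_mulVecLin_add_rank {V : Type*} [Fintype V] (A : Matrix V V ℝ) :
    Module.finrank ℝ (LinearMap.ker A.mulVecLin) + A.rank = Fintype.card V := by
  rw [add_comm]
  simpa [Matrix.rank] using A.mulVecLin.finrank_range_add_finrank_ker

/-- Relabelling the vertices and switching the signs along a cut. -/
theorem RealizesNullity.switch {V W : Type*} [Fintype V] [Fintype W] (e : V ≃ W) (σ : W → Bool)
    {Ev Od : W → W → Prop} {Ev' Od' : V → V → Prop}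
    (hsame : ∀ x y, σ (e x) = σ (e y) →
      (Ev' x y ↔ Ev (e x) (e y)) ∧ (Od' x y ↔ Od (e x) (e y)))
    (hdiff : ∀ x y, σ (e x) ≠ σ (e y) →
      (Ev' x y ↔ Od (e x) (e y)) ∧ (Od' x y ↔ Ev (e x) (e y))) {k : ℕ}
    (h : RealizesNullity Ev Od k) : RealizesNullity Ev' Od' k := by
  classical
  obtain ⟨A, hA, hpsd, hsap, rfl⟩ := h
  obtain ⟨s, hs⟩ : ∃ s : W → ℝ, s = fun w => if σ w then 1 else -1 := ⟨_, rfl⟩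
  have hss : ∀ w, s w * s w = 1 := fun w => by rw [hs]; dsimp only; split_ifs <;> norm_num
  have hs1 : ∀ {x y}, σ x = σ y → s x * s y = 1 := fun {x y} h => by
    rw [← hss x, hs]; simp only [h]
  have hs2 : ∀ {x y}, σ x ≠ σ y → s x * s y = -1 := fun {x y} h => by
    rw [hs]; dsimp only
    cases hx : σ x <;> cases hy : σ y <;> simp_all
  -- Conjugation by this involution flips exactly the entries across the cut; test matrices are
  -- conjugated in the same way.
  obtain ⟨D, hD⟩ : ∃ D, D = diagonal s := ⟨_, rfl⟩
  have hDt : Dᵀ = D := by rw [hD, diagonal_transpose]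
  have hDD : D * D = 1 := by
    rw [hD, diagonal_mul_diagonal, ← diagonal_one]
    exact congrArg diagonal (funext hss)
  have hDu : IsUnit D.det := by
    refine (isUnit_iff_isUnit_det _).mp (IsUnit.of_mul_eq_one D hDD)
  obtain ⟨B, hB⟩ : ∃ B, B = (D * A * D).submatrix e e := ⟨_, rfl⟩
  have hBapp : ∀ x y, B x y = s (e x) * s (e y) * A (e x) (e y) := fun x y => by
    rw [hB, submatrix_apply, hD, mul_diagonal, diagonal_mul]; ring
  have hBsymm : B.IsSymm := by
    ext x y
    rw [transpose_apply, hBapp, hBapp, hA.symm.apply, mul_comm (s (e x))]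
  refine ⟨B, ⟨hBsymm, ?_, ?_, ?_⟩, ?_, ?_, ?_⟩
  · intro x y hxy hE hO
    rw [hBapp]
    by_cases h : σ (e x) = σ (e y)
    · rw [(hsame x y h).1] at hE
      rw [(hsame x y h).2] at hO
      rw [hs1 h, one_mul]
      exact hA.neg _ _ (e.injective.ne hxy) hE hO
    · rw [(hdiff x y h).1] at hE
      rw [(hdiff x y h).2] at hO
      rw [hs2 h, neg_one_mul, neg_lt_zero]
      exact hA.pos _ _ (e.injective.ne hxy) hE hO
  · intro x y hxy hO hE
    rw [hBapp]
    by_cases h : σ (e x) = σ (e y)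
    · rw [(hsame x y h).1] at hE
      rw [(hsame x y h).2] at hO
      rw [hs1 h, one_mul]
      exact hA.pos _ _ (e.injective.ne hxy) hO hE
    · rw [(hdiff x y h).1] at hE
      rw [(hdiff x y h).2] at hO
      rw [hs2 h, neg_one_mul, neg_pos]
      exact hA.neg _ _ (e.injective.ne hxy) hO hE
  · intro x y hxy hE hO
    rw [hBapp]
    by_cases h : σ (e x) = σ (e y)
    · rw [(hsame x y h).1] at hE
      rw [(hsame x y h).2] at hO
      rw [hA.zero _ _ (e.injective.ne hxy) hE hO, mul_zero]
    · rw [(hdiff x y h).1] at hE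
      rw [(hdiff x y h).2] at hO
      rw [hA.zero _ _ (e.injective.ne hxy) hO hE, mul_zero]
  · rw [hB]
    have := hpsd.mul_mul_conjTranspose_same D
    rw [conjTranspose_eq_transpose_of_trivial, hDt] at this
    exact this.submatrix e
  · intro X hX hX0 hBX
    have hY := hsap (D * X.submatrix e.symm e.symm * D) ?_ ?_ ?_
    · ext x y
      have := congrFun (congrFun hY (e x)) (e y)
      rw [hD, mul_diagonal, diagonal_mul, submatrix_apply, e.symm_apply_apply,
        e.symm_apply_apply, Matrix.zero_apply] at this
      have h1 : X x y = s (e x) * (s (e x) * X x y * s (e y)) * s (e y) := by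
        linear_combination (-(s (e y) * s (e y)) * X x y) * hss (e x) - X x y * hss (e y)
      rw [h1, this, mul_zero, zero_mul, Matrix.zero_apply]
    · rw [IsSymm, transpose_mul, transpose_mul, hDt, transpose_submatrix, hX.eq, Matrix.mul_assoc]
    · intro i j hij
      rw [hD, mul_diagonal, diagonal_mul, submatrix_apply, hX0 _ _ ?_, mul_zero, zero_mul]
      rcases hij with rfl | hij
      · exact Or.inl rfl
      · refine Or.inr ?_
        change Ev' _ _ ∨ Od' _ _
        have h1 := hsame (e.symm i) (e.symm j)
        have h2 := hdiff (e.symm i) (e.symm j)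
        simp only [e.apply_symm_apply] at h1 h2
        by_cases h : σ i = σ j
        · rw [(h1 h).1, (h1 h).2]; exact hij
        · rw [(h2 h).1, (h2 h).2]; exact hij.symm
    · have h1 : D * A * D * X.submatrix e.symm e.symm = 0 := by
        have h2 : B.submatrix e.symm e.symm = D * A * D := by rw [hB]; simp
        rw [← h2, submatrix_mul_equiv, hBX]
        rfl
      have h2 : A * (D * X.submatrix e.symm e.symm * D) =
          D * (D * A * D * X.submatrix e.symm e.symm) * D := by
        simp only [← Matrix.mul_assoc, hDD, Matrix.one_mul]
      rw [h2, h1]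
      simp
  · have hrank : B.rank = A.rank := by
      rw [hB, rank_submatrix, rank_mul_eq_left_of_isUnit_det _ _ hDu,
        rank_mul_eq_right_of_isUnit_det _ _ hDu]
    have h1 := B.finrank_ker_mulVecLin_add_rank
    have h2 := A.finrank_ker_mulVecLin_add_rank
    rw [hrank, Fintype.card_congr e] at h1
    omega

/-! ### Signed graphs as pairs of relations; nullity one -/

namespace SignedGraph

variable {α β : Type*} (G : SignedGraph α β)

theorem hasNullity_iff_realizesNullity (k : ℕ) : G.HasNullity k ↔ RealizesNullity
    (fun i j : G.Vertex => ∃ f, G.graph.IsLink f i j ∧ f ∉ G.odd)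
    (fun i j : G.Vertex => ∃ f, G.graph.IsLink f i j ∧ f ∈ G.odd) k := by
  have hadj : ∀ i j : G.Vertex, G.graph.Adj i j ↔
      (∃ f, G.graph.IsLink f i j ∧ f ∉ G.odd) ∨ ∃ f, G.graph.IsLink f i j ∧ f ∈ G.odd := by
    intro i j
    constructor
    · rintro ⟨f, hf⟩
      by_cases h : f ∈ G.odd
      · exact Or.inr ⟨f, hf, h⟩
      · exact Or.inl ⟨f, hf, h⟩
    · rintro (⟨f, hf, -⟩ | ⟨f, hf, -⟩) <;> exact ⟨f, hf⟩
  have hne : ∀ i j : G.Vertex, G.graph.Adj i j → i ≠ j := by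
    rintro i j ⟨e, h⟩ rfl
    exact G.loopless.not_isLoopAt e _ h
  constructor
  · rintro ⟨A, hA, hpsd, hsap, hk⟩
    refine ⟨A, ⟨hA.symm, ?_, ?_, ?_⟩, hpsd, ?_, hk⟩
    · rintro i j - ⟨f, hf, -⟩ hO
      exact hA.neg i j ⟨f, hf⟩ fun f' hf' ho => hO ⟨f', hf', ho⟩
    · rintro i j - ⟨f, hf, -⟩ hE
      exact hA.pos i j ⟨f, hf⟩ fun f' hf' => by_contra fun ho => hE ⟨f', hf', ho⟩
    · intro i j hij hE hO
      exact hA.zero i j hij fun h => ((hadj i j).mp h).elim hE hO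
    · simpa only [StrongArnold, HasSAP, ← hadj] using hsap
  · rintro ⟨A, hA, hpsd, hsap, hk⟩
    refine ⟨A, ⟨hA.symm, ?_, ?_, ?_⟩, hpsd, ?_, hk⟩
    · rintro i j h hE
      have hO : ¬ ∃ f, G.graph.IsLink f i j ∧ f ∈ G.odd := fun ⟨f, hf, ho⟩ => hE f hf ho
      exact hA.neg i j (hne i j h) (((hadj i j).mp h).resolve_right hO) hO
    · rintro i j h hO
      have hE : ¬ ∃ f, G.graph.IsLink f i j ∧ f ∉ G.odd := fun ⟨f, hf, ho⟩ => ho (hO f hf)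
      exact hA.pos i j (hne i j h) (((hadj i j).mp h).resolve_left hE) hE
    · intro i j hij h
      rw [hadj, not_or] at h
      exact hA.zero i j hij h.1 h.2
    · simpa only [StrongArnold, HasSAP, ← hadj] using hsap

theorem hasNullity_iff_of_equiv {V : Type*} [Fintype V] (e : V ≃ G.Vertex) (σ : α → Bool)
    {Ev Od : V → V → Prop}
    (hEv : ∀ x y, Ev x y ↔
      ∃ f, G.graph.IsLink f (e x) (e y) ∧ (f ∈ G.odd ↔ σ (e x) ≠ σ (e y)))
    (hOd : ∀ x y, Od x y ↔
      ∃ f, G.graph.IsLink f (e x) (e y) ∧ ¬ (f ∈ G.odd ↔ σ (e x) ≠ σ (e y))) (k : ℕ) :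
    G.HasNullity k ↔ RealizesNullity Ev Od k := by
  rw [hasNullity_iff_realizesNullity]
  constructor
  · refine RealizesNullity.switch e (fun v => σ v) ?_ ?_
    · intro x y h
      simp [hEv, hOd, h]
    · intro x y h
      simp [hEv, hOd, h]
  · refine RealizesNullity.switch e.symm (fun x => σ (e x)) ?_ ?_
    · intro x y h
      simp only [e.apply_symm_apply] at h
      simp [hEv, hOd, h]
    · intro x y h
      simp only [e.apply_symm_apply] at h
      simp [hEv, hOd, h]

/-- Start from a positive definite `P` with the right signs and lower one diagonal entry until the
matrix becomes singular. The kernel is then the line through `y = P⁻¹ b`, with `y v ≠ 0`, which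
makes the Strong Arnold Property automatic. -/
theorem hasNullity_one (hG : V(G.graph).Nonempty) : G.HasNullity 1 := by
  classical
  obtain ⟨-, A, hA, hpsd, -, -⟩ := G.exists_hasNullity
  obtain ⟨v⟩ : Nonempty G.Vertex := hG.to_subtype
  obtain ⟨P, hPdef⟩ : ∃ P, P = A + 1 := ⟨_, rfl⟩
  have hP : P.PosDef := by rw [hPdef]; exact PosDef.posSemidef_add hpsd PosDef.one
  obtain ⟨b, hb⟩ : ∃ b : G.Vertex → ℝ, b = Pi.single v 1 := ⟨_, rfl⟩
  obtain ⟨y, hy⟩ : ∃ y, y = P⁻¹ *ᵥ b := ⟨_, rfl⟩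
  have hPy : P *ᵥ y = b := by rw [hy, mulVec_mulVec, hP.self_mul_inv, one_mulVec]
  have hinv : ∀ x, P⁻¹ *ᵥ (P *ᵥ x) = x := fun x => by
    rw [mulVec_mulVec, hP.inv_mul_self, one_mulVec]
  have hbx : ∀ x, b ⬝ᵥ x = x v := fun x => by rw [hb, single_one_dotProduct]
  have hxb : ∀ x, x ⬝ᵥ b = x v := fun x => by rw [dotProduct_comm, hbx]
  have hy0 : y ≠ 0 := by
    rintro h
    rw [h, mulVec_zero] at hPy
    have := congrFun hPy v
    rw [hb, Pi.single_eq_same] at this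
    exact zero_ne_one this
  have hyv : 0 < y v := by
    have := hP.dotProduct_mulVec_pos hy0
    rwa [star_trivial, hPy, hxb] at this
  obtain ⟨B, hB⟩ : ∃ B, B = P - (y v)⁻¹ • vecMulVec b b := ⟨_, rfl⟩
  have hBx : ∀ x, B *ᵥ x = P *ᵥ x - ((y v)⁻¹ * x v) • b := fun x => by
    rw [hB, sub_mulVec, smul_mulVec, vecMulVec_mulVec, hbx, op_smul_eq_smul, smul_smul]
  have hker : ∀ x, B *ᵥ x = 0 ↔ x = ((y v)⁻¹ * x v) • y := by
    intro x
    rw [hBx, sub_eq_zero]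
    constructor
    · intro h
      calc x = P⁻¹ *ᵥ (P *ᵥ x) := (hinv x).symm
        _ = _ := by rw [h, mulVec_smul, ← hy]
    · intro h
      calc P *ᵥ x = P *ᵥ (((y v)⁻¹ * x v) • y) := congrArg _ h
        _ = _ := by rw [mulVec_smul, hPy]
  have hBsymm : B.IsSymm := by
    rw [hB, IsSymm, transpose_sub, transpose_smul, hP.isSymm.eq, transpose_vecMulVec]
  have hBoff : ∀ i j, i ≠ j → B i j = A i j := by
    intro i j hij
    have : b i * b j = 0 := by
      by_cases hi : i = v
      · rw [hb, Pi.single_eq_of_ne (fun h => hij (hi.trans h.symm)), mul_zero]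
      · rw [hb, Pi.single_eq_of_ne hi, zero_mul]
    rw [hB, hPdef, Matrix.sub_apply, Matrix.smul_apply, vecMulVec_apply, this, Matrix.add_apply,
      one_apply_ne hij]
    simp
  have hne : ∀ i j : G.Vertex, G.graph.Adj i j → i ≠ j := by
    rintro i j ⟨e, h⟩ rfl
    exact G.loopless.not_isLoopAt e _ h
  refine ⟨B, ⟨hBsymm, ?_, ?_, ?_⟩, ?_, ?_, ?_⟩
  · intro i j h h'
    rw [hBoff i j (hne i j h)]
    exact hA.neg i j h h'
  · intro i j h h'
    rw [hBoff i j (hne i j h)]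
    exact hA.pos i j h h'
  · intro i j h h'
    rw [hBoff i j h]
    exact hA.zero i j h h'
  · refine .of_dotProduct_mulVec_nonneg
      (by rwa [IsHermitian, conjTranspose_eq_transpose_of_trivial]) fun x => ?_
    obtain ⟨t, ht⟩ : ∃ t, t = (y v)⁻¹ * x v := ⟨_, rfl⟩
    have hxv : x v = t * y v := by rw [ht]; field_simp
    -- Completing the square: the form of `B` at `x` equals the form of `P` at `x - t • y`.
    have h1 := hP.posSemidef.dotProduct_mulVec_nonneg (x - t • y)
    have h2 : y ⬝ᵥ (P *ᵥ x) = x v := by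
      rw [dotProduct_mulVec, ← mulVec_transpose, hP.isSymm.eq, hPy, hbx]
    rw [star_trivial] at h1 ⊢
    rw [mulVec_sub, mulVec_smul, hPy, sub_dotProduct, dotProduct_sub, dotProduct_sub,
      smul_dotProduct, smul_dotProduct, dotProduct_smul, dotProduct_smul, h2, hxb, hxb] at h1
    rw [hBx, ← ht, dotProduct_sub, dotProduct_smul, hxb]
    simp only [smul_eq_mul, hxv] at h1 ⊢
    linarith
  · intro X hX hX0 hBX
    have hcol : ∀ j i, X i j = (y v)⁻¹ * X v j * y i := by
      intro j i
      have h1 : B *ᵥ (fun i => X i j) = 0 := by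
        ext i
        exact congrFun (congrFun hBX i) j
      exact congrFun ((hker _).mp h1) i
    -- Each column of `X` is the multiple of `y` fixed by its entry at `v`. Column `v` has entry 0
    -- there, so it vanishes, and by symmetry so does row `v`.
    have hrow : ∀ j, X v j = 0 := by
      intro j
      rw [← hX.apply, hcol v j, hX0 v v (Or.inl rfl)]
      ring
    ext i j
    rw [hcol, hrow]
    simp
  · have hspan : LinearMap.ker B.mulVecLin = Submodule.span ℝ {y} := by
      ext x
      rw [LinearMap.mem_ker, mulVecLin_apply, hker, Submodule.mem_span_singleton]
      constructor
      · intro h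
        exact ⟨_, h.symm⟩
      · rintro ⟨t, rfl⟩
        simp only [Pi.smul_apply, smul_eq_mul]
        congr 1
        field_simp
    rw [hspan, finrank_span_singleton hy0]

end SignedGraph

/-! ### Walks, and balance of bipartite signed graphs -/

theorem List.exists_split_of_not_nodup_map {γ δ : Type*} (f : γ → δ) :
    ∀ {l : List γ}, ¬ (l.map f).Nodup →
      ∃ l₁ a l₂ b l₃, l = l₁ ++ a :: (l₂ ++ b :: l₃) ∧ f a = f b
  | [], h => absurd List.nodup_nil h
  | c :: l, h => by
    by_cases hc : f c ∈ l.map f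
    · obtain ⟨b, hb, hbc⟩ := List.mem_map.mp hc
      obtain ⟨l₂, l₃, rfl⟩ := List.append_of_mem hb
      exact ⟨[], c, l₂, b, l₃, rfl, hbc.symm⟩
    · have hl : ¬ (l.map f).Nodup := fun hl => h (List.nodup_cons.mpr ⟨hc, hl⟩)
      obtain ⟨l₁, a, l₂, b, l₃, rfl, hab⟩ := exists_split_of_not_nodup_map f hl
      exact ⟨c :: l₁, a, l₂, b, l₃, rfl, hab⟩

namespace Graph

variable {α β : Type*} {G : Graph α β} {x y z : α} {l l' : List (β × α)} {p : β × α}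

theorem isWalk_cons : G.IsWalk x (p :: l) z ↔ G.IsLink p.1 x p.2 ∧ G.IsWalk p.2 l z := by
  constructor
  · intro h
    cases h with
    | cons h hl => exact ⟨h, hl⟩
  · rintro ⟨h, hl⟩
    exact .cons h hl

theorem IsWalk.eq_of_nil (h : G.IsWalk x [] y) : x = y := by
  cases h; rfl

theorem isWalk_append : G.IsWalk x (l ++ l') z ↔ ∃ y, G.IsWalk x l y ∧ G.IsWalk y l' z := by
  induction l generalizing x with
  | nil =>
    constructor
    · intro h
      have hx : x ∈ V(G) := by
        cases h with
        | nil hx => exact hx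
        | cons h _ => exact h.left_mem
      exact ⟨x, .nil hx, h⟩
    · rintro ⟨y, hy, h⟩
      rwa [hy.eq_of_nil]
  | cons p l ih =>
    simp only [List.cons_append, isWalk_cons, ih]
    constructor
    · rintro ⟨h, y, h1, h2⟩
      exact ⟨y, ⟨h, h1⟩, h2⟩
    · rintro ⟨y, ⟨h, h1⟩, h2⟩
      exact ⟨h, y, h1, h2⟩

theorem IsWalk.mem_of_ne_nil (h : G.IsWalk x l y) (hl : l ≠ []) : y ∈ l.map Prod.snd := by
  induction h with
  | nil _ => exact absurd rfl hl
  | @cons x z y e l h hw ih =>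
    rcases l with _ | ⟨p, l⟩
    · simp [hw.eq_of_nil]
    · exact List.mem_cons_of_mem _ (ih (by simp))

theorem IsWalk.mem_cons (h : G.IsWalk x l y) : y ∈ x :: l.map Prod.snd := by
  rcases eq_or_ne l [] with rfl | hl
  · simp [h.eq_of_nil]
  · exact List.mem_cons_of_mem _ (h.mem_of_ne_nil hl)

end Graph

namespace SignedGraph

open Graph

variable {α β : Type*} (G : SignedGraph α β)

theorem oddCount_append (l l' : List (β × α)) :
    G.oddCount (l ++ l') = G.oddCount l + G.oddCount l' := by
  simp [oddCount]

theorem oddCount_cons_eq (p q : β × α) (h : p.1 = q.1) (l : List (β × α)) :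
    G.oddCount (p :: l) = G.oddCount (q :: l) := by
  simp only [oddCount, List.countP_cons]
  rw [h]

/-- A repeated vertex cuts a closed odd walk into two shorter closed walks, one of them odd, so
induction on the length applies. -/
theorem exists_odd_cycle (n : ℕ) : ∀ {x : α} {l : List (β × α)}, l.length ≤ n →
    G.graph.IsWalk x l x → Odd (G.oddCount l) →
    ∃ y l', G.graph.IsCycle y l' ∧ Odd (G.oddCount l') := by
  induction n with
  | zero =>
    intro x l hn _ hodd
    rw [List.length_eq_zero_iff.mp (Nat.le_zero.mp hn)] at hodd
    simp [oddCount] at hodd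
  | succ n ih =>
    intro x l hn hw hodd
    by_cases hsnd : (l.map Prod.snd).Nodup
    · refine ⟨x, l, ⟨hw, ?_, ?_, hsnd⟩, hodd⟩
      · rintro rfl
        simp [oddCount] at hodd
      -- Without repeated vertices, an edge can recur only when traversed in opposite directions,
      -- and then the walk is that edge back and forth, which is even.
      · by_contra hfst
        obtain ⟨l₁, ⟨e, v⟩, l₂, ⟨e', v'⟩, l₃, rfl, rfl : e = e'⟩ :=
          List.exists_split_of_not_nodup_map _ hfst
        obtain ⟨p, hw₁, hw⟩ := isWalk_append.mp hw
        obtain ⟨hlink, hw⟩ := isWalk_cons.mp hw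
        obtain ⟨q, hw₂, hw⟩ := isWalk_append.mp hw
        obtain ⟨hlink', hw₃⟩ := isWalk_cons.mp hw
        dsimp only at hlink hlink' hw₂ hw₃
        simp only [List.map_append, List.map_cons, List.nodup_append, List.nodup_cons,
          List.mem_append, List.mem_cons] at hsnd
        obtain ⟨-, ⟨hv, -, ⟨hv', -⟩, -⟩, h₁⟩ := hsnd
        rcases hlink.eq_and_eq_or_eq_and_eq hlink' with ⟨-, rfl⟩ | ⟨rfl, rfl⟩
        · exact hv (Or.inr (Or.inl rfl))
        have hl₂ : l₂ = [] := by
          by_contra h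
          exact hv (Or.inl (hw₂.mem_of_ne_nil h))
        have hl₁ : l₁ = [] := by
          by_contra h
          exact h₁ _ (hw₁.mem_of_ne_nil h) _ (Or.inr (Or.inr (Or.inl rfl))) rfl
        subst hl₁ hl₂
        obtain rfl := hw₁.eq_of_nil
        have hl₃ : l₃ = [] := by
          by_contra h
          exact hv' (hw₃.mem_of_ne_nil h)
        subst hl₃
        by_cases he : e ∈ G.odd
        · simp [oddCount, he] at hodd
          exact absurd hodd (by decide)
        · simp [oddCount, he] at hodd
    · obtain ⟨l₁, ⟨e, v⟩, l₂, ⟨e', v'⟩, l₃, rfl, rfl : v = v'⟩ :=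
        List.exists_split_of_not_nodup_map _ hsnd
      obtain ⟨p, hw₁, hw⟩ := isWalk_append.mp hw
      obtain ⟨hlink, hw⟩ := isWalk_cons.mp hw
      obtain ⟨q, hw₂, hw⟩ := isWalk_append.mp hw
      obtain ⟨hlink', hw₃⟩ := isWalk_cons.mp hw
      dsimp only at hlink hlink' hw₂ hw₃
      simp only [List.length_append, List.length_cons] at hn
      have hinner : G.graph.IsWalk v (l₂ ++ [(e', v)]) v :=
        isWalk_append.mpr ⟨q, hw₂, isWalk_cons.mpr ⟨hlink', .nil hlink'.right_mem⟩⟩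
      have houter : G.graph.IsWalk x (l₁ ++ (e, v) :: l₃) x :=
        isWalk_append.mpr ⟨p, hw₁, isWalk_cons.mpr ⟨hlink, hw₃⟩⟩
      have hsum : G.oddCount (l₁ ++ (e, v) :: (l₂ ++ (e', v) :: l₃)) =
          G.oddCount (l₂ ++ [(e', v)]) + G.oddCount (l₁ ++ (e, v) :: l₃) := by
        simp only [oddCount, List.countP_append, List.countP_cons, List.countP_nil]
        omega
      by_cases hodd' : Odd (G.oddCount (l₂ ++ [(e', v)]))
      · exact ih (by simp only [List.length_append, List.length_cons, List.length_nil]; omega)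
          hinner hodd'
      · rw [Nat.not_odd_iff_even] at hodd'
        rw [hsum, Nat.odd_add', iff_true_right hodd'] at hodd
        exact ih (by simp only [List.length_append, List.length_cons]; omega) houter hodd

theorem exists_reverse_walk {x y : α} {l : List (β × α)} (h : G.graph.IsWalk x l y) :
    ∃ l', G.graph.IsWalk y l' x ∧ G.oddCount l' = G.oddCount l := by
  induction h with
  | nil hx => exact ⟨[], .nil hx, rfl⟩
  | @cons x z y e l h _ ih =>
    obtain ⟨l', hw, hl'⟩ := ih
    refine ⟨l' ++ [(e, x)], isWalk_append.mpr
      ⟨z, hw, isWalk_cons.mpr ⟨h.symm, .nil h.left_mem⟩⟩, ?_⟩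
    rw [oddCount_append, hl', ← List.singleton_append (l := l), oddCount_append, add_comm,
      G.oddCount_cons_eq (e, x) (e, z) rfl]

/-- A connected bipartite signed graph is balanced: its odd edges form a cut. -/
theorem IsBipartite.exists_cut {G : SignedGraph α β} (hG : G.IsBipartite)
    (hconn : G.graph.IsConnected) :
    ∃ σ : α → Bool, ∀ e x y, G.graph.IsLink e x y → (e ∈ G.odd ↔ σ x ≠ σ y) := by
  classical
  obtain ⟨⟨r, hr⟩, hpath⟩ := hconn
  choose! π hπ using fun y hy => hpath r hr y hy
  -- The side of `y` is the parity of a chosen path from the root. Two such paths and an edge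
  -- joining their ends form a closed walk, which is even.
  refine ⟨fun y => decide (Odd (G.oddCount (π y))), fun e x y h => ?_⟩
  obtain ⟨l', hw', hl'⟩ := G.exists_reverse_walk (hπ y h.right_mem).1
  have hclosed : G.graph.IsWalk r (π x ++ (e, y) :: l') r :=
    isWalk_append.mpr ⟨x, (hπ x h.left_mem).1, isWalk_cons.mpr ⟨h, hw'⟩⟩
  have heven : ¬ Odd (G.oddCount (π x ++ (e, y) :: l')) := fun hodd => by
    obtain ⟨z, l, hl, hlodd⟩ := G.exists_odd_cycle _ le_rfl hclosed hodd
    exact hG z l hl hlodd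
  rw [← List.singleton_append (l := l'), oddCount_append, oddCount_append, hl'] at heven
  have he : G.oddCount [(e, y)] = if e ∈ G.odd then 1 else 0 := by
    simp [oddCount, List.countP_cons]
  rw [he] at heven
  simp only [ne_eq, decide_eq_decide, Nat.odd_iff] at heven ⊢
  split_ifs at heven with h'
  · simp only [h', true_iff]; omega
  · simp only [h', false_iff]; omega

theorem odd_oddCount_iff {G : SignedGraph α β} {σ : α → Bool}
    (hσ : ∀ e x y, G.graph.IsLink e x y → (e ∈ G.odd ↔ σ x ≠ σ y)) {x y : α}
    {l : List (β × α)} (h : G.graph.IsWalk x l y) : Odd (G.oddCount l) ↔ σ x ≠ σ y := by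
  classical
  induction h with
  | nil _ => simp [oddCount]
  | @cons x z y e l h _ ih =>
    have he : G.oddCount [(e, z)] = if e ∈ G.odd then 1 else 0 := by
      simp [oddCount, List.countP_cons]
    rw [← List.singleton_append (l := l), oddCount_append, he, Nat.odd_add', ih]
    have := hσ e x z h
    split_ifs with h'
    · rw [this.eq, ne_eq] at h'
      cases hx : σ x <;> cases hy : σ y <;> cases hz : σ z <;> simp_all
    · rw [this.eq, ne_eq, not_not] at h'
      cases hx : σ x <;> cases hy : σ y <;> cases hz : σ z <;> simp_all

theorem hasOddPath_iff {G : SignedGraph α β} (hconn : G.graph.IsConnected) {σ : α → Bool}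
    (hσ : ∀ e x y, G.graph.IsLink e x y → (e ∈ G.odd ↔ σ x ≠ σ y)) {x y : α}
    (hx : x ∈ V(G.graph)) (hy : y ∈ V(G.graph)) : G.HasOddPath x y ↔ σ x ≠ σ y := by
  constructor
  · rintro ⟨l, hl, hodd⟩
    exact (odd_oddCount_iff hσ hl.1).mp hodd
  · intro h
    obtain ⟨l, hl⟩ := hconn.2 x hx y hy
    exact ⟨l, hl, (odd_oddCount_iff hσ hl.1).mpr h⟩

end SignedGraph

/-! ### The two networks of a 3-split -/

/-- The claw on `R ⊕ Unit` joining the new vertex to the three terminals. -/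
def clawRel {R : Type*} (u : Fin 3 → R) (x y : R ⊕ Unit) : Prop :=
  ∃ i, (x = Sum.inl (u i) ∧ y = Sum.inr ()) ∨ (x = Sum.inr () ∧ y = Sum.inl (u i))

theorem isTripodNetwork_clawRel {R : Type*} (u : Fin 3 → R) :
    IsTripodNetwork u (clawRel u) where
  symm := by
    rintro x y ⟨i, ⟨rfl, rfl⟩ | ⟨rfl, rfl⟩⟩
    · exact ⟨i, Or.inr ⟨rfl, rfl⟩⟩
    · exact ⟨i, Or.inl ⟨rfl, rfl⟩⟩
  mem_range := by
    rintro r x ⟨i, ⟨h, -⟩ | ⟨h, -⟩⟩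
    · exact ⟨i, (Sum.inl.inj h).symm⟩
    · cases h
  grounded _ := Or.inl ⟨u 0, .single ⟨0, Or.inr ⟨rfl, rfl⟩⟩⟩
  claw := ⟨(), fun i => .single ⟨⟨i, Or.inr ⟨rfl, rfl⟩⟩, rfl⟩⟩

namespace SignedGraph

open Graph

variable {α β : Type*} {G : SignedGraph α β} {E₁ E₂ : Set β} {u : Fin 3 → α}

/-- The edges in `F` with respect to a labelling `φ` of vertices. -/
def linkRel {V : Type*} (G : SignedGraph α β) (F : Set β) (φ : V → α) (x y : V) : Prop :=
  ∃ f ∈ F, G.graph.IsLink f (φ x) (φ y)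

theorem exists_reflTransGen_linkRel {V : Type*} {F : Set β} {φ : V → α}
    (hφ : ∀ v ∈ V(G.graph), ∃ x, φ x = v) {a b : α} {l : List (β × α)}
    (h : (G.edgeSubgraph F).graph.IsWalk a l b) (x : V) (hx : φ x = a) :
    ∃ y, φ y = b ∧ ReflTransGen (G.linkRel F φ) x y := by
  induction h generalizing x with
  | nil _ => exact ⟨x, hx, .refl⟩
  | @cons a c b e l h _ ih =>
    obtain ⟨z, hz⟩ := hφ c h.2.right_mem
    obtain ⟨y, hy, hzy⟩ := ih z hz
    exact ⟨y, hy, .head ⟨e, h.1, by rw [hx, hz]; exact h.2⟩ hzy⟩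

/-- A vertex of `R` met by the network is a terminal. A simple path to `u i` avoiding the other two
terminals therefore stays in `C` until its end. -/
theorem reflTransGen_linkRel_of_avoids {R C : Type*} {F : Set β} {φ : R ⊕ C → α}
    (hinj : Function.Injective φ) (hφ : ∀ v ∈ V(G.graph), ∃ x, φ x = v)
    (hterm : ∀ r, φ (Sum.inl r) ∈ V((G.edgeSubgraph F).graph) → φ (Sum.inl r) ∈ Set.range u)
    {a : α} {i : Fin 3} {r : R} (hr : φ (Sum.inl r) = u i) {l : List (β × α)}
    (h : (G.edgeSubgraph F).graph.IsWalk a l (u i)) (hnodup : (a :: l.map Prod.snd).Nodup)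
    (havoid : ∀ j, j ≠ i → u j ∉ a :: l.map Prod.snd) (x : R ⊕ C) (hx : φ x = a) :
    ReflTransGen (fun x y => G.linkRel F φ x y ∧ x.isRight) x (Sum.inl r) := by
  generalize hb : u i = b at h
  induction h generalizing x with
  | nil _ => rw [hinj (hx.trans (hb.symm.trans hr.symm))]
  | @cons a c b e l h hw ih =>
    obtain ⟨z, hz⟩ := hφ c h.2.right_mem
    have hnodup' := List.nodup_cons.mp hnodup
    refine .head ⟨⟨e, h.1, by rw [hx, hz]; exact h.2⟩, ?_⟩
      (ih hnodup'.2 (fun j hj hmem => havoid j hj (List.mem_cons_of_mem _ hmem)) z hz hb)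
    rcases x with s | d
    · exfalso
      obtain ⟨j, hj⟩ := hterm s (by rw [hx]; exact h.left_mem)
      rw [hx] at hj
      by_cases hij : j = i
      · refine hnodup'.1 ?_
        rw [← hj, hij, hb]
        exact hw.mem_cons
      · exact havoid j hij (by rw [hj]; exact List.mem_cons_self)
    · rfl

theorem IsThreeSplit.mem_left (hsplit : G.IsThreeSplit E₁ E₂ u) (i : Fin 3) :
    u i ∈ V((G.edgeSubgraph E₁).graph) := by
  have : u i ∈ Set.range u := ⟨i, rfl⟩
  rw [hsplit.range_eq] at this
  exact this.1

theorem IsThreeSplit.mem_right (hsplit : G.IsThreeSplit E₁ E₂ u) (i : Fin 3) :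
    u i ∈ V((G.edgeSubgraph E₂).graph) := by
  have : u i ∈ Set.range u := ⟨i, rfl⟩
  rw [hsplit.range_eq] at this
  exact this.2

theorem vertexSet_edgeSubgraph_subset (G : SignedGraph α β) (F : Set β) :
    V((G.edgeSubgraph F).graph) ⊆ V(G.graph) := fun _ ⟨_, _, h⟩ => h.vertex_mem

/-- The vertices of `G` that are not incident with an edge of `E₁`. -/
abbrev Outside (G : SignedGraph α β) (E₁ : Set β) : Type _ :=
  {v : α // v ∈ V(G.graph) ∧ v ∉ V((G.edgeSubgraph E₁).graph)}

noncomputable instance (G : SignedGraph α β) (E₁ : Set β) : Fintype (G.Outside E₁) :=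
  (G.finite_vertexSet.subset fun _ h => h.1).fintype

/-- The vertices of `G`, split into those of the part on `E₁` and the other ones. -/
noncomputable def splitEquiv (G : SignedGraph α β) (E₁ : Set β) :
    (G.edgeSubgraph E₁).Vertex ⊕ G.Outside E₁ ≃ G.Vertex :=
  Equiv.ofBijective
    (Sum.elim (fun r => ⟨r, G.vertexSet_edgeSubgraph_subset E₁ r.2⟩) fun c => ⟨c, c.2.1⟩) (by
      constructor
      · rintro (r | c) (s | d) h
        · exact congrArg Sum.inl (Subtype.ext (Subtype.mk.inj h))
        · exact absurd (congrArg Subtype.val h ▸ r.2) d.2.2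
        · exact absurd ((congrArg Subtype.val h).symm ▸ s.2) c.2.2
        · exact congrArg Sum.inr (Subtype.ext (Subtype.mk.inj h))
      · intro v
        by_cases hv : v.1 ∈ V((G.edgeSubgraph E₁).graph)
        · exact ⟨Sum.inl ⟨v, hv⟩, rfl⟩
        · exact ⟨Sum.inr ⟨v, v.2, hv⟩, rfl⟩)

/-- The vertices of the part on `E₁` with a claw attached. -/
noncomputable def clawEquiv (hsplit : G.IsThreeSplit E₁ E₂ u) :
    (G.edgeSubgraph E₁).Vertex ⊕ Unit ≃ (G.clawPart E₁ E₂ u).Vertex :=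
  Equiv.ofBijective
    (Sum.elim (fun r => ⟨some r, Set.mem_insert_of_mem _ ⟨r, Or.inl r.2, rfl⟩⟩)
      fun _ => ⟨none, Set.mem_insert _ _⟩) (by
      constructor
      · rintro (r | c) (s | d) h
        · exact congrArg Sum.inl (Subtype.ext (Option.some.inj (congrArg Subtype.val h)))
        · exact absurd (congrArg Subtype.val h) (by simp)
        · exact absurd (congrArg Subtype.val h) (by simp)
        · rfl
      · rintro ⟨v, rfl | ⟨v, hv, rfl⟩⟩
        · exact ⟨Sum.inr (), rfl⟩
        · refine ⟨Sum.inl ⟨v, ?_⟩, rfl⟩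
          rcases hv with hv | ⟨i, rfl⟩
          · exact hv
          · exact hsplit.mem_left i)

/-- The terminals as vertices of the part on `E₁`. -/
def IsThreeSplit.terminal (hsplit : G.IsThreeSplit E₁ E₂ u) (i : Fin 3) :
    (G.edgeSubgraph E₁).Vertex := ⟨u i, hsplit.mem_left i⟩

theorem IsThreeSplit.isTripodNetwork (hsplit : G.IsThreeSplit E₁ E₂ u)
    (hclaw : G.HasRootedClaw E₂ u) :
    IsTripodNetwork hsplit.terminal (G.linkRel E₂ fun x => (G.splitEquiv E₁ x : α)) := by
  have hinj : Function.Injective fun x => (G.splitEquiv E₁ x : α) :=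
    Subtype.val_injective.comp (G.splitEquiv E₁).injective
  have hsurj : ∀ v ∈ V(G.graph), ∃ x, (G.splitEquiv E₁ x : α) = v := fun v hv =>
    ⟨(G.splitEquiv E₁).symm ⟨v, hv⟩, by simp⟩
  have hterm : ∀ r : (G.edgeSubgraph E₁).Vertex,
      r.1 ∈ V((G.edgeSubgraph E₂).graph) → r.1 ∈ Set.range u := fun r hr => by
    rw [hsplit.range_eq]
    exact ⟨r.2, hr⟩
  refine ⟨?_, ?_, ?_, ?_⟩
  · rintro x y ⟨f, hf, h⟩
    exact ⟨f, hf, h.symm⟩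
  · rintro r x ⟨f, hf, h⟩
    obtain ⟨i, hi⟩ := hterm r ⟨f, hf, h.inc_left⟩
    exact ⟨i, Subtype.ext hi⟩
  · intro c
    by_cases hc : c.1 ∈ V((G.edgeSubgraph E₂).graph)
    · obtain ⟨l, hl⟩ := hsplit.connected.2 _ hc _ (hsplit.mem_right 0)
      obtain ⟨y, hy, hcy⟩ := exists_reflTransGen_linkRel hsurj hl.1 (Sum.inr c) rfl
      have : y = Sum.inl (hsplit.terminal 0) := hinj hy
      exact Or.inl ⟨_, this ▸ hcy⟩
    -- A vertex outside both edge parts is isolated in `G`; this is why `IsTripodNetwork` tolerates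
    -- isolated vertices.
    · refine Or.inr ?_
      rintro x ⟨f, hf, h⟩
      exact hc ⟨f, hf, h.inc_left⟩
  · obtain ⟨w, hw, hwu, hpath⟩ := hclaw
    have hw₁ : w ∉ V((G.edgeSubgraph E₁).graph) := fun hw₁ => by
      obtain ⟨i, hi⟩ := hterm ⟨w, hw₁⟩ hw
      exact hwu i hi.symm
    refine ⟨⟨w, G.vertexSet_edgeSubgraph_subset E₂ hw, hw₁⟩, fun i => ?_⟩
    obtain ⟨l, hl, havoid⟩ := hpath i
    refine reflTransGen_linkRel_of_avoids (u := u) hinj hsurj hterm rfl hl.1 hl.2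
      (fun j hj hmem => ?_) _ rfl
    rcases List.mem_cons.mp hmem with h | h
    · exact hwu j h.symm
    · exact havoid j hj h

end SignedGraph

/-! ### Both signed graphs after switching -/

namespace SignedGraph

open Graph

variable {α β : Type*} {G : SignedGraph α β} {E₁ E₂ : Set β} {u : Fin 3 → α}

/-- The edges in `E₁` that are even after switching the signs along the cut `σ`. -/
def evenRel (G : SignedGraph α β) (E₁ : Set β) (σ : α → Bool)
    (r s : (G.edgeSubgraph E₁).Vertex) : Prop :=
  ∃ f ∈ E₁, G.graph.IsLink f r s ∧ (f ∈ G.odd ↔ σ r ≠ σ s)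

/-- The edges in `E₁` that are odd after switching the signs along the cut `σ`. -/
def oddRel (G : SignedGraph α β) (E₁ : Set β) (σ : α → Bool)
    (r s : (G.edgeSubgraph E₁).Vertex) : Prop :=
  ∃ f ∈ E₁, G.graph.IsLink f r s ∧ ¬ (f ∈ G.odd ↔ σ r ≠ σ s)

theorem IsThreeSplit.hasNullity_iff (hsplit : G.IsThreeSplit E₁ E₂ u) {σ : α → Bool}
    (hσ : ∀ e x y, (G.edgeSubgraph E₂).graph.IsLink e x y →
      (e ∈ (G.edgeSubgraph E₂).odd ↔ σ x ≠ σ y)) (k : ℕ) :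
    G.HasNullity k ↔ RealizesNullity
      (fun x y => leftRel (G.evenRel E₁ σ) x y ∨
        G.linkRel E₂ (fun x => (G.splitEquiv E₁ x : α)) x y)
      (leftRel (G.oddRel E₁ σ)) k := by
  have hE₂ : ∀ f ∈ E₂, ∀ x y, G.graph.IsLink f x y → (f ∈ G.odd ↔ σ x ≠ σ y) :=
    fun f hf x y h => by
      rw [← hσ f x y ⟨hf, h⟩]
      exact ⟨fun h => ⟨hf, h⟩, fun h => h.2⟩
  have hmem : ∀ {f x y}, G.graph.IsLink f x y → f ∈ E₁ ∨ f ∈ E₂ := fun {f x y} h => by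
    have := h.edge_mem
    rwa [← hsplit.union_eq] at this
  have hleft : ∀ {f x y}, f ∈ E₁ → G.graph.IsLink f x y →
      x ∈ V((G.edgeSubgraph E₁).graph) ∧ y ∈ V((G.edgeSubgraph E₁).graph) := fun {f x y} hf h =>
    ⟨⟨f, hf, h.inc_left⟩, ⟨f, hf, h.inc_right⟩⟩
  refine G.hasNullity_iff_of_equiv (G.splitEquiv E₁) σ (fun x y => ?_) (fun x y => ?_) k
  · constructor
    · rintro (h | ⟨f, hf, h⟩)
      · rcases x with r | c <;> rcases y with s | d
        · obtain ⟨f, -, h⟩ := h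
          exact ⟨f, h⟩
        all_goals exact h.elim
      · exact ⟨f, h, hE₂ f hf _ _ h⟩
    · rintro ⟨f, h, hodd⟩
      rcases hmem h with hf | hf
      · rcases x with r | c
        · rcases y with s | d
          · exact Or.inl ⟨f, hf, h, hodd⟩
          · exact absurd (hleft hf h).2 d.2.2
        · exact absurd (hleft hf h).1 c.2.2
      · exact Or.inr ⟨f, hf, h⟩
  · constructor
    · intro h
      rcases x with r | c <;> rcases y with s | d
      · obtain ⟨f, -, h⟩ := h
        exact ⟨f, h⟩
      all_goals exact h.elim
    · rintro ⟨f, h, hodd⟩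
      rcases hmem h with hf | hf
      · rcases x with r | c
        · rcases y with s | d
          · exact ⟨f, hf, h, hodd⟩
          · exact absurd (hleft hf h).2 d.2.2
        · exact absurd (hleft hf h).1 c.2.2
      · exact absurd (hE₂ f hf _ _ h) hodd

theorem IsThreeSplit.clawPart_hasNullity_iff (hsplit : G.IsThreeSplit E₁ E₂ u) {σ : α → Bool}
    (hσ : ∀ e x y, (G.edgeSubgraph E₂).graph.IsLink e x y →
      (e ∈ (G.edgeSubgraph E₂).odd ↔ σ x ≠ σ y)) (k : ℕ) :
    (G.clawPart E₁ E₂ u).HasNullity k ↔ RealizesNullity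
      (fun x y => leftRel (G.evenRel E₁ σ) x y ∨ clawRel hsplit.terminal x y)
      (leftRel (G.oddRel E₁ σ)) k := by
  have hinl : ∀ f ∈ E₁, (Sum.inl f ∈ (G.clawPart E₁ E₂ u).odd ↔ f ∈ G.odd) := fun f hf => by
    constructor
    · rintro (⟨g, hg, hgf⟩ | ⟨i, -, hi⟩)
      · cases hgf
        exact hg.2
      · cases hi
    · exact fun h => Or.inl ⟨f, ⟨hf, h⟩, rfl⟩
  have hinr : ∀ i, (Sum.inr i ∈ (G.clawPart E₁ E₂ u).odd ↔ σ (u i) ≠ σ (u 0)) := fun i => by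
    have hpath := hasOddPath_iff hsplit.connected hσ (hsplit.mem_right 0) (hsplit.mem_right i)
    constructor
    · rintro (⟨g, -, hg⟩ | ⟨j, ⟨-, hj⟩, hji⟩)
      · cases hg
      · cases hji
        exact (hpath.mp hj).symm
    · intro h
      exact Or.inr ⟨i, ⟨fun hi => h (by rw [hi]), hpath.mpr h.symm⟩, rfl⟩
  refine (G.clawPart E₁ E₂ u).hasNullity_iff_of_equiv (clawEquiv hsplit)
    -- Placing the new vertex on the side of `u 0` makes all three claw edges even after switching.
    (fun v => v.elim (σ (u 0)) σ) (fun x y => ?_) (fun x y => ?_) k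
  · constructor
    · rintro (h | ⟨i, ⟨rfl, rfl⟩ | ⟨rfl, rfl⟩⟩)
      · rcases x with r | c <;> rcases y with s | d
        · obtain ⟨f, hf, h, hodd⟩ := h
          exact ⟨Sum.inl f, Or.inl ⟨f, r, s, rfl, rfl, rfl, hf, h⟩, (hinl f hf).trans hodd⟩
        all_goals exact h.elim
      · exact ⟨Sum.inr i, Or.inr ⟨i, rfl, Or.inl ⟨rfl, rfl⟩⟩, hinr i⟩
      · exact ⟨Sum.inr i, Or.inr ⟨i, rfl, Or.inr ⟨rfl, rfl⟩⟩, (hinr i).trans ne_comm⟩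
    · rintro ⟨e, h, hodd⟩
      rcases h with ⟨f, a, b, rfl, hx, hy, hf, h⟩ | ⟨i, rfl, h⟩
      · rcases x with r | c
        · rcases y with s | d
          · cases hx
            cases hy
            exact Or.inl ⟨f, hf, h, (hinl f hf).symm.trans hodd⟩
          · cases hy
        · cases hx
      · refine Or.inr ⟨i, h.imp ?_ ?_⟩
        · rintro ⟨hx, hy⟩
          exact ⟨(clawEquiv hsplit).injective (Subtype.ext hx),
            (clawEquiv hsplit).injective (Subtype.ext hy)⟩
        · rintro ⟨hx, hy⟩
          exact ⟨(clawEquiv hsplit).injective (Subtype.ext hx),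
            (clawEquiv hsplit).injective (Subtype.ext hy)⟩
  · constructor
    · intro h
      rcases x with r | c <;> rcases y with s | d
      · obtain ⟨f, hf, h, hodd⟩ := h
        exact ⟨Sum.inl f, Or.inl ⟨f, r, s, rfl, rfl, rfl, hf, h⟩,
          fun h' => hodd ((hinl f hf).symm.trans h')⟩
      all_goals exact h.elim
    · rintro ⟨e, h, hodd⟩
      rcases h with ⟨f, a, b, rfl, hx, hy, hf, h⟩ | ⟨i, rfl, h⟩
      · rcases x with r | c
        · rcases y with s | d
          · cases hx
            cases hy
            exact ⟨f, hf, h, fun h' => hodd ((hinl f hf).trans h')⟩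
          · cases hy
        · cases hx
      · refine absurd ?_ hodd
        rcases h with ⟨hx, hy⟩ | ⟨hx, hy⟩
        · rw [hx, hy]
          exact hinr i
        · rw [hx, hy]
          exact (hinr i).trans ne_comm

end SignedGraph

/-! ### Comparison of the two parameters -/

theorem mainTheorem3 {α β : Type*} (G : SignedGraph α β) (E₁ E₂ : Set β) (u : Fin 3 → α)
    (hsplit : G.IsThreeSplit E₁ E₂ u) (hclaw : G.HasRootedClaw E₂ u) :
    G.nu = (G.clawPart E₁ E₂ u).nu := by
  obtain ⟨σ, hσ⟩ := hsplit.bipartite.exists_cut hsplit.connected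
  have hu : Function.Injective hsplit.terminal := fun i j h =>
    hsplit.injective (congrArg Subtype.val h)
  have hEv : ∀ r s, G.evenRel E₁ σ r s → G.evenRel E₁ σ s r := by
    rintro r s ⟨f, hf, h, hodd⟩
    exact ⟨f, hf, h.symm, hodd.trans ne_comm⟩
  have hOd : ∀ r s, G.oddRel E₁ σ r s → G.oddRel E₁ σ s r := by
    rintro r s ⟨f, hf, h, hodd⟩
    exact ⟨f, hf, h.symm, fun h' => hodd (h'.trans ne_comm)⟩
  have hnet := hsplit.isTripodNetwork hclaw
  have hnet' := isTripodNetwork_clawRel hsplit.terminal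
  have hiff : ∀ k, 2 ≤ k → (G.HasNullity k ↔ (G.clawPart E₁ E₂ u).HasNullity k) := by
    intro k hk
    rw [hsplit.hasNullity_iff hσ, hsplit.clawPart_hasNullity_iff hσ]
    exact ⟨.replace_network hu hEv hOd hnet hnet' hk, .replace_network hu hEv hOd hnet' hnet hk⟩
  -- The exchange of networks needs nullity at least 2; a maximum equal to 1 is covered by this
  -- bound for the other graph.
  have hone : 1 ≤ G.nu := G.isGreatest_nu.2 (G.hasNullity_one
    ⟨u 0, G.vertexSet_edgeSubgraph_subset E₁ (hsplit.mem_left 0)⟩)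
  have hone' : 1 ≤ (G.clawPart E₁ E₂ u).nu := (G.clawPart E₁ E₂ u).isGreatest_nu.2
    ((G.clawPart E₁ E₂ u).hasNullity_one ⟨none, Set.mem_insert _ _⟩)
  refine le_antisymm ?_ ?_
  · rcases hone.eq_or_lt with h | h
    · rwa [← h]
    · exact (G.clawPart E₁ E₂ u).isGreatest_nu.2 ((hiff _ h).mp G.isGreatest_nu.1)
  · rcases hone'.eq_or_lt with h | h
    · rwa [← h]
    · exact G.isGreatest_nu.2 ((hiff _ h).mpr (G.clawPart E₁ E₂ u).isGreatest_nu.1)
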